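/- **Setting.** Let $N\ge 2$, let $L\ge 1$ be an odd integer, and let $\phi:\mathbb R\to\mathbb R$ be continuous with $\phi(t)=0$ for $t\notin[0,N]$. Put $V(\phi)=\{\sum_{k\in\mathbb Z}c(k)\phi(\cdot-k):\ c(k)\in\mathbb R\}$. A signal $f\in V(\phi)$ is *separable* if $f=f_1+f_2$ with nonzero $f_1,f_2\in V(\phi)$ and $f_1f_2=0$; otherwise it is *nonseparable*. Let $X=\{x_1,\dots,x_{2N-1}\}\subset(0,1)$ be such that all $N\times N$ submatrices of $\Phi=(\phi(x_m+n))_{1\le m\le 2N-1,\,0\le n\le N-1}$ are nonsingular. Let $\Gamma=\{\gamma_1,\dots,\gamma_N\}\subset X$ and $\Gamma^*=\{\gamma_1^*,\dots,\gamma_N^*\}\subset X$ consist of $N$ distinct points each, with $\phi(\gamma_n)\ne0$ and $\phi(\gamma_n^*+N-1)\neq 0$ for all $n$. With $\|A\|=\sup_{\|v\|_2=1}\|Av\|_2$, put $$\|(\Phi_N)^{-1}\|=\sup_{1\le m_0<\dots<m_{N-1}\le 2N-1}\Big\|\big((\phi(x_{m_l}+n))_{0\le l,n\le N-1}\big)^{-1}\Big\|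 .$$ Let $f=\sum_{k}c(k)\phi(\cdot-k)\in V(\phi)$ be a nonzero nonseparable signal, $K_-=\inf\{k:c(k)\ne0\}$, $K_+=\sup\{k:c(k)\ne 0\}$ (possibly infinite), and suppose that $$S_f=\inf_{K_--N+1<k<K_++1}\ \sum_{l=0}^{N-2}|c(k+l)|^2>0,\qquad M_f=\sup_{K_--N+1<k<K_++1}\frac{\sum_{l=-1}^{N-1}|c(k+l)|^2}{\sum_{l=0}^{N-2}|c(k+l)|^2}<\infty .$$ Put $$C_{f,\phi}=\frac{2^8\,\|\Phi\|^4\,\|(\Phi_N)^{-1}\|^3 M_f}{\min_{1\le n\le N}\{|\phi(\gamma_n)|,|\phi(\gamma_n^*+N-1)|\}} .$$ The samples are $z_\epsilon(y)=|f(y)|^2+\epsilon(y)$, $y\in Y_L$, where $Y_L=\big(X\cup\{\gamma_n+l,\ \gamma_n^*-l':1\le n\le N,\ 1\le l,l'\le\frac{L-1}2\}\big)+L\mathbb Z$ and $\epsilon$ is bounded on $Y_L$; put $|\epsilon|=\sup_{y\in Y_L}|\epsilon(y)|$. Square roots of negative numbers, if any occur, are read as $0$. **The MEPS algorithm with threshold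 $M_0$.** For $v,e,e_1,e_2\in\mathbb R^N$ with all $v(n)\neq0$ let $$h_1(v;e)=\frac{\begin{vmatrix}\sum v(n)^2&\sum v(n)e(n)\\ \sum v(n)e(n)&\sum e(n)^2\end{vmatrix}}{\sum v(n)^2},\qquad h_2(v;e_1,e_2)=\frac{\begin{vmatrix}\sum v(n)^2&\sum e_2(n)\\ \sum v(n)e_1(n)&\sum \frac{e_1(n)e_2(n)}{v(n)}\end{vmatrix}}{\sum v(n)^2}.$$ (i) For each $k'\in\mathbb Z$ let $c^0_{k'}:\mathbb Z\to\mathbb R$ vanish outside $[k'L-N+1,k'L]$ and there be a minimizer of $$\sum_{m=1}^{2N-1}\Big|\Big|\sum_{k=k'L-N+1}^{k'L}d(k)\phi(x_m+k'L-k)\Big|-\sqrt{z_\epsilon(x_m+k'L)}\Big|^2 .$$ (ii) Put $c^{1/2}_{k',0}=c^0_{k'}$. For $1\le l\le\frac{L-1}2$ let $p=k'L+l$, $v(n)=\phi(\gamma_n)$ and $\alpha(n)=\sum_{m=1}^{N-1}c^{1/2}_{k',l-1}(p-m)\phi(\gamma_n+m)$. If $|h_1(v;\alpha)|\le M_0$,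 then $c^{1/2}_{k',l}$ is $c^{1/2}_{k',l-1}$ with its $p$-th component replaced by $\sum_n|v(n)|\sqrt{z_\epsilon(\gamma_n+p)}\big/\sum_n|v(n)|^2$. If $|h_1(v;\alpha)|>M_0$, put $\eta(n)=z_\epsilon(\gamma_n+p)-|\alpha(n)|^2$ and $d=h_2(v;\alpha,\eta)/(2h_1(v;\alpha))$, and replace the components at $p-m$, $0\le m\le N-1$, by the solution $d(p-m)$ of $$\sum_{m=0}^{N-1}d(p-m)\phi(\gamma_n+m)=\operatorname{sgn}\big(\alpha(n)+d\,v(n)\big)\sqrt{z_\epsilon(\gamma_n+p)},\qquad 1\le n\le N,$$ where $\operatorname{sgn}$ takes values in $\{-1,0,1\}$. (iii) Put $c^1_{k',0}=c^{1/2}_{k',(L-1)/2}$. For $1\le l'\le\frac{L-1}2$ let $q=k'L-l'$, $v(n)=\phi(\gamma^*_n+N-1)$ and $\alpha(n)=\sum_{m=0}^{N-2}c^{1}_{k',l'-1}(q-m)\phi(\gamma^*_n+m)$. If $|h_1(v;\alpha)|\le M_0$, then $c^1_{k',l'}$ is $c^1_{k',l'-1}$ with its $(q-N+1)$-th component replaced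 by $\sum_n|v(n)|\sqrt{z_\epsilon(\gamma^*_n+q)}\big/\sum_n|v(n)|^2$. If $|h_1(v;\alpha)|>M_0$, put $\eta(n)=z_\epsilon(\gamma^*_n+q)-|\alpha(n)|^2$ and $d=h_2(v;\alpha,\eta)/(2h_1(v;\alpha))$, and replace the components at $q-m$, $0\le m\le N-1$, by the solution $d(q-m)$ of $$\sum_{m=0}^{N-1}d(q-m)\phi(\gamma^*_n+m)=\operatorname{sgn}\big(\alpha(n)+d\,v(n)\big)\sqrt{z_\epsilon(\gamma^*_n+q)},\qquad 1\le n\le N.$$ Put $c^1_{k'}=c^1_{k',(L-1)/2}$. (iv) Choose signs $\tilde\delta_{k'}\in\{-1,1\}$ such that $c^2_{k'}=\tilde\delta_{k'}c^1_{k'}$ satisfy $\langle c^2_{k'},c^2_{k'+1}\rangle=\sum_{k\in\mathbb Z}c^2_{k'}(k)c^2_{k'+1}(k)\ge0$ for all $k'\in\mathbb Z$. (v) Put $c_\epsilon(k)=c^2_{k'}(k)$ with $k'=\lfloor(2k+L-1)/(2L)\rfloor$, $k\in\mathbb Z$. **Theorem.** Let $c_\epsilon$ be any output of the MEPS algorithm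 (for any admissible choice of the minimizers in (i) and of the signs in (iv)) with threshold $M_0=S_f/(4\|(\Phi_N)^{-1}\|^2)$. If $$|\epsilon|\le\frac{S_f}{2^7N^3\,\|(\Phi_N)^{-1}\|^2\,(C_{f,\phi})^{4N+L-5}},$$ then there exists $\delta\in\{-1,1\}$ such that, for all $k\in\mathbb Z$, $$|c_\epsilon(k)-\delta c(k)|\le N\,\|(\Phi_N)^{-1}\|\,(C_{f,\phi})^{N-1+(L-1)/2}\sqrt{8|\epsilon|}.$$ -/

import Mathlib

noncomputable section

namespace MEPS

/-! ### Signals in a shift-invariant space -/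

/-- The signal `t ↦ ∑_{k ∈ ℤ} c(k) φ(t - k)`.  For a compactly supported generator `φ` only
finitely many terms are nonzero for each `t`. -/
def signal (φ : ℝ → ℝ) (c : ℤ → ℝ) (t : ℝ) : ℝ :=
  ∑' k : ℤ, c k * φ (t - k)

/-- The shift-invariant space `V(φ)`. -/
def V (φ : ℝ → ℝ) : Set (ℝ → ℝ) :=
  Set.range (signal φ)

/-- A signal is separable in `W` if it is the sum of two nonzero signals of `W` whose product
vanishes identically. -/
def Separable (W : Set (ℝ → ℝ)) (f : ℝ → ℝ) : Prop :=
  ∃ f₁ ∈ W, ∃ f₂ ∈ W, f₁ ≠ 0 ∧ f₂ ≠ 0 ∧ f = f₁ + f₂ ∧ f₁ * f₂ = 0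

/-- `K₋ = inf {k : c(k) ≠ 0}`, possibly infinite. -/
def Kminus (c : ℤ → ℝ) : EReal :=
  ⨅ k ∈ {k : ℤ | c k ≠ 0}, ((k : ℝ) : EReal)

/-- `K₊ = sup {k : c(k) ≠ 0}`, possibly infinite. -/
def Kplus (c : ℤ → ℝ) : EReal :=
  ⨆ k ∈ {k : ℤ | c k ≠ 0}, ((k : ℝ) : EReal)

/-- The integers `k` with `K₋ - N + 1 < k < K₊ + 1`. -/
def window (N : ℕ) (c : ℤ → ℝ) : Set ℤ :=
  {k : ℤ | Kminus c - ((N : ℝ) : EReal) + 1 < ((k : ℝ) : EReal) ∧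
    ((k : ℝ) : EReal) < Kplus c + 1}

/-- The window in terms of the nonzero coefficients. -/
theorem mem_window_iff (N : ℕ) (c : ℤ → ℝ) (k : ℤ) :
    k ∈ window N c ↔ (∃ j : ℤ, c j ≠ 0 ∧ j < k + N - 1) ∧ ∃ j : ℤ, c j ≠ 0 ∧ k - 1 < j := by
  have e1 : (Kminus c - ((N : ℝ) : EReal) + 1 < ((k : ℝ) : EReal)) ↔
      Kminus c < (((k + N - 1 : ℤ) : ℝ) : EReal) := by
    induction Kminus c with
    | bot => simp only [EReal.bot_sub, EReal.bot_add, EReal.bot_lt_coe]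
    | top =>
      have h : (⊤ : EReal) - ((N : ℝ) : EReal) + 1 = ⊤ := by
        rw [EReal.top_sub_coe]; rfl
      rw [h]
      simp only [not_top_lt]
    | coe a =>
      norm_cast
      push_cast
      constructor <;> intro h <;> linarith
  have e2 : (((k : ℝ) : EReal) < Kplus c + 1) ↔ (((k - 1 : ℤ) : ℝ) : EReal) < Kplus c := by
    induction Kplus c with
    | bot => simp
    | top =>
      have h : (⊤ : EReal) + 1 = ⊤ := rfl
      rw [h]
      simp only [EReal.coe_lt_top]
    | coe a =>
      norm_cast
      push_cast
      constructor <;> intro h <;> linarith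
  simp only [window, Set.mem_ofPred_eq]
  rw [e1, e2]
  simp only [Kminus, Kplus, iInf_lt_iff, lt_iSup_iff, Set.mem_ofPred_eq, EReal.coe_lt_coe_iff,
    Int.cast_lt, exists_prop]

/-- The quantities `∑_{l=0}^{N-2} |c(k+l)|²`. -/
def windowEnergy (N : ℕ) (c : ℤ → ℝ) (k : ℤ) : ℝ :=
  ∑ l ∈ Finset.Icc (0 : ℤ) (N - 2), |c (k + l)| ^ 2

/-- The quotients `(∑_{l=-1}^{N-1} |c(k+l)|²) / (∑_{l=0}^{N-2} |c(k+l)|²)`. -/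
def windowRatio (N : ℕ) (c : ℤ → ℝ) (k : ℤ) : ℝ :=
  (∑ l ∈ Finset.Icc (-1 : ℤ) (N - 1), |c (k + l)| ^ 2) / windowEnergy N c k

/-- `S_f`, the infimum of the window energies.  (For `c = 0` the window is empty and this real
infimum is `0`, so `0 < S N c` includes that the signal is nonzero.) -/
def S (N : ℕ) (c : ℤ → ℝ) : ℝ :=
  sInf (windowEnergy N c '' window N c)

/-- `M_f`, the supremum of the window ratios; it is meaningful if `MFinite N c` holds. -/
def M (N : ℕ) (c : ℤ → ℝ) : ℝ :=
  sSup (windowRatio N c '' window N c)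

/-- `M_f < ∞` (used together with `0 < S N c`, which makes all denominators positive). -/
def MFinite (N : ℕ) (c : ℤ → ℝ) : Prop :=
  BddAbove (windowRatio N c '' window N c)

/-! ### The sampling matrix -/

/-- The matrix `Φ = (φ(x_m + n))`, with `2N - 1` rows and columns `0 ≤ n ≤ N - 1`. -/
def Phi (φ : ℝ → ℝ) (N : ℕ) (x : Fin (2 * N - 1) → ℝ) : Matrix (Fin (2 * N - 1)) (Fin N) ℝ :=
  Matrix.of fun m n => φ (x m + (n : ℕ))

/-- The `N × N` submatrix with the rows `s(0) < ... < s(N-1)`. -/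
def PhiSub (φ : ℝ → ℝ) (N : ℕ) (x : Fin (2 * N - 1) → ℝ) (s : Fin N ↪o Fin (2 * N - 1)) :
    Matrix (Fin N) (Fin N) ℝ :=
  (Phi φ N x).submatrix s id

/-- All `N × N` submatrices of `Φ` are nonsingular. -/
def FullSpark (φ : ℝ → ℝ) (N : ℕ) (x : Fin (2 * N - 1) → ℝ) : Prop :=
  ∀ s : Fin N ↪o Fin (2 * N - 1), (PhiSub φ N x s).det ≠ 0

/-- The operator norm `‖A‖ = sup_{‖v‖₂ = 1} ‖A v‖₂` between Euclidean spaces. -/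
def opNorm {m n : ℕ} (A : Matrix (Fin m) (Fin n) ℝ) : ℝ :=
  ‖LinearMap.toContinuousLinearMap (Matrix.toEuclideanLin A)‖

/-- `‖(Φ_N)⁻¹‖`: the largest norm of the inverse of an `N × N` submatrix of `Φ`. -/
def normInv (φ : ℝ → ℝ) (N : ℕ) (x : Fin (2 * N - 1) → ℝ) : ℝ :=
  ⨆ s : Fin N ↪o Fin (2 * N - 1), opNorm (PhiSub φ N x s)⁻¹

/-- The constant `C_{f,φ}`. -/
def constC (φ : ℝ → ℝ) (N : ℕ) (x : Fin (2 * N - 1) → ℝ) (γ γs : Fin N → ℝ) (c : ℤ → ℝ) : ℝ :=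
  2 ^ 8 * opNorm (Phi φ N x) ^ 4 * normInv φ N x ^ 3 * M N c /
    (⨅ n : Fin N, min |φ (γ n)| |φ (γs n + (N - 1))|)

/-! ### Sampling set and noisy samples -/

/-- `Y_L = (X ∪ {Γ + l, Γ* - l' : 1 ≤ l, l' ≤ (L-1)/2}) + Lℤ`. -/
def sampleSet (N L : ℕ) (x : Fin (2 * N - 1) → ℝ) (γ γs : Fin N → ℝ) : Set ℝ :=
  {y : ℝ | ∃ y₀ : ℝ, ∃ j : ℤ, y = y₀ + L * j ∧
    (y₀ ∈ Set.range x ∨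
      (∃ n : Fin N, ∃ l : ℕ, 1 ≤ l ∧ l ≤ (L - 1) / 2 ∧ y₀ = γ n + l) ∨
      (∃ n : Fin N, ∃ l : ℕ, 1 ≤ l ∧ l ≤ (L - 1) / 2 ∧ y₀ = γs n - l))}

/-- The noise level `sup {|ε(y)| : y ∈ Y}`. -/
def noiseLevel (Y : Set ℝ) (ε : ℝ → ℝ) : ℝ :=
  sSup ((fun y => |ε y|) '' Y)

/-- The noisy phaseless samples `z_ε(y) = |f(y)|² + ε(y)`. -/
def noisySample (f ε : ℝ → ℝ) (y : ℝ) : ℝ :=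
  |f y| ^ 2 + ε y

/-! ### The MEPS algorithm -/

/-- The functions `h₁` (for `v(n) = φ(γ_n)`) and `h₁*` (for `v(n) = φ(γ_n* + N - 1)`). -/
def h1 {N : ℕ} (v e : Fin N → ℝ) : ℝ :=
  Matrix.det !![∑ n, |v n| ^ 2, ∑ n, v n * e n; ∑ n, v n * e n, ∑ n, |e n| ^ 2] /
    ∑ n, |v n| ^ 2

/-- The functions `h₂` (for `v(n) = φ(γ_n)`) and `h₂*` (for `v(n) = φ(γ_n* + N - 1)`). -/
def h2 {N : ℕ} (v e₁ e₂ : Fin N → ℝ) : ℝ :=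
  Matrix.det !![∑ n, |v n| ^ 2, ∑ n, e₂ n; ∑ n, v n * e₁ n, ∑ n, e₁ n * e₂ n / v n] /
    ∑ n, |v n| ^ 2

/-- The objective function of the local minimization problem on the block
`[p - N + 1, p]`, where `p = k'L`. -/
def objective (φ : ℝ → ℝ) (N : ℕ) (x : Fin (2 * N - 1) → ℝ) (z : ℝ → ℝ) (p : ℤ) (d : ℤ → ℝ) : ℝ :=
  ∑ m : Fin (2 * N - 1),
    |(|∑ k ∈ Finset.Icc (p - N + 1) p, d k * φ (x m + p - k)| - √(z (x m + p)))| ^ 2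

/-- Minimization: `d` is supported in `[p - N + 1, p]` and minimizes the objective function. -/
def IsLocalMinimizer (φ : ℝ → ℝ) (N : ℕ) (x : Fin (2 * N - 1) → ℝ) (z : ℝ → ℝ) (p : ℤ)
    (d : ℤ → ℝ) : Prop :=
  (∀ k : ℤ, k ≤ p - N ∨ p + 1 ≤ k → d k = 0) ∧
    ∀ d' : ℤ → ℝ, objective φ N x z p d ≤ objective φ N x z p d'

/-- The closed-form least squares value used when `|h₁| ≤ M₀`; the `n`-th sample is taken at
`y n`. -/
def lsqValue {N : ℕ} (v : Fin N → ℝ) (z : ℝ → ℝ) (y : Fin N → ℝ) : ℝ :=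
  (∑ n, |v n| * √(z (y n))) / ∑ n, |v n| ^ 2

/-- The number `h₂(α, η) / (2 h₁(α))` with `η(n) = z(y n) - |α(n)|²`. -/
def predicted {N : ℕ} (v α : Fin N → ℝ) (z : ℝ → ℝ) (y : Fin N → ℝ) : ℝ :=
  h2 v α (fun n => z (y n) - |α n| ^ 2) / (2 * h1 v α)

/-- The signed sample `sgn(α(n) + d v(n)) √z(y n)`. -/
def signedSample {N : ℕ} (v α : Fin N → ℝ) (z : ℝ → ℝ) (y : Fin N → ℝ) (n : Fin N) : ℝ :=
  Real.sign (α n + predicted v α z y * v n) * √(z (y n))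

/-- `c'` arises from `c` by replacing the components on `[p - N + 1, p]` by a solution of the
linear system `∑_{m=0}^{N-1} c'(p - m) φ(g_n + m) = b_n`, `1 ≤ n ≤ N`. -/
def IsSystemUpdate (φ : ℝ → ℝ) {N : ℕ} (g b : Fin N → ℝ) (p : ℤ) (c c' : ℤ → ℝ) : Prop :=
  (∀ k : ℤ, k < p - N + 1 ∨ p < k → c' k = c k) ∧
    ∀ n : Fin N, ∑ m ∈ Finset.range N, c' (p - m) * φ (g n + m) = b n

/-- The vector `α(n) = ∑_{m=1}^{N-1} c(p - m) φ(γ_n + m)`. -/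
def alphaFwd (φ : ℝ → ℝ) {N : ℕ} (γ : Fin N → ℝ) (c : ℤ → ℝ) (p : ℤ) (n : Fin N) : ℝ :=
  ∑ m ∈ Finset.Icc 1 (N - 1), c (p - m) * φ (γ n + m)

/-- The vector `α*(n) = ∑_{m=0}^{N-2} c(q - m) φ(γ*_n + m)`. -/
def alphaBwd (φ : ℝ → ℝ) {N : ℕ} (γs : Fin N → ℝ) (c : ℤ → ℝ) (q : ℤ) (n : Fin N) : ℝ :=
  ∑ m ∈ Finset.Icc 0 (N - 2), c (q - m) * φ (γs n + m)

/-- One forward extension step, from `c` to `c'`, determining the component at `p = k'L + l`. -/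
def ForwardStep (φ : ℝ → ℝ) {N : ℕ} (γ : Fin N → ℝ) (z : ℝ → ℝ) (M₀ : ℝ) (p : ℤ)
    (c c' : ℤ → ℝ) : Prop :=
  let v : Fin N → ℝ := fun n => φ (γ n)
  let y : Fin N → ℝ := fun n => γ n + p
  let α : Fin N → ℝ := alphaFwd φ γ c p
  (|h1 v α| ≤ M₀ → c' = Function.update c p (lsqValue v z y)) ∧
    (M₀ < |h1 v α| → IsSystemUpdate φ γ (signedSample v α z y) p c c')

/-- One backward extension step, from `c` to `c'`, with `q = k'L - l'`, determining the component
at `q - N + 1`. -/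
def BackwardStep (φ : ℝ → ℝ) {N : ℕ} (γs : Fin N → ℝ) (z : ℝ → ℝ) (M₀ : ℝ) (q : ℤ)
    (c c' : ℤ → ℝ) : Prop :=
  let v : Fin N → ℝ := fun n => φ (γs n + (N - 1))
  let y : Fin N → ℝ := fun n => γs n + q
  let α : Fin N → ℝ := alphaBwd φ γs c q
  (|h1 v α| ≤ M₀ → c' = Function.update c (q - N + 1) (lsqValue v z y)) ∧
    (M₀ < |h1 v α| → IsSystemUpdate φ γs (signedSample v α z y) q c c')

/-- `cε` is an output of the MEPS algorithm (minimization, extension, phase adjustment, sewing)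
with samples `z` and threshold `M₀`.  Here `cHalf k' l` and `cOne k' l'` are the intermediate
vectors of the forward and of the backward extension, and `σ k'` are the adjusting signs.  A
minimizer and the signs need not be unique; every admissible choice is an output. -/
def IsOutput (φ : ℝ → ℝ) (N L : ℕ) (x : Fin (2 * N - 1) → ℝ) (γ γs : Fin N → ℝ)
    (z : ℝ → ℝ) (M₀ : ℝ) (cε : ℤ → ℝ) : Prop :=
  ∃ (cHalf cOne : ℤ → ℕ → ℤ → ℝ) (σ : ℤ → ℝ),
    (∀ k' : ℤ, IsLocalMinimizer φ N x z (k' * L) (cHalf k' 0)) ∧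
    (∀ k' : ℤ, ∀ l : ℕ, 1 ≤ l → l ≤ (L - 1) / 2 →
      ForwardStep φ γ z M₀ (k' * L + l) (cHalf k' (l - 1)) (cHalf k' l)) ∧
    (∀ k' : ℤ, cOne k' 0 = cHalf k' ((L - 1) / 2)) ∧
    (∀ k' : ℤ, ∀ l : ℕ, 1 ≤ l → l ≤ (L - 1) / 2 →
      BackwardStep φ γs z M₀ (k' * L - l) (cOne k' (l - 1)) (cOne k' l)) ∧
    (∀ k' : ℤ, σ k' = 1 ∨ σ k' = -1) ∧
    (∀ k' : ℤ, 0 ≤ ∑' k : ℤ,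
      (σ k' * cOne k' ((L - 1) / 2) k) * (σ (k' + 1) * cOne (k' + 1) ((L - 1) / 2) k)) ∧
    (∀ k : ℤ, cε k =
      σ ⌊(2 * k + L - 1 : ℝ) / (2 * L)⌋ * cOne ⌊(2 * k + L - 1 : ℝ) / (2 * L)⌋ ((L - 1) / 2) k)

end MEPS

end

noncomputable section

namespace MEPS

open Matrix

/-! Write `A` and `B` for the norms of `Φ` and of the inverses of its square submatrices, `μ` for
the minimum in the denominator of `C_{f,φ}`, `K = C_{f,φ}`, `E` for the noise level and `L = 2h +
1`. On `p + X` the signal is `Φ` applied to the block `c(p), ..., c(p-N+1)`. Two real vectors of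
`2N-1` samples with nearly equal moduli nearly agree, or nearly agree up to sign, on at least `N`
rows. Full spark then controls a block up to sign, and a local minimizer has error at most `B√(8NE)`
(`exists_sign_of_isLocalMinimizer`).

An extension step sees one new coefficient `t`, with samples `f = β + t v` and `β` coming from `N-1`
known coefficients. Since `(f² - β²)/v = 2tβ + t²v`, pairing with the part of `β` orthogonal to `v`
removes the quadratic term; this is what `h₂/(2h₁)` computes. The prediction fixes the signs of the
samples, and the linear system is solved again. By the definition of `S_f`, the known window either
has energy at least `S_f` or vanishes, and the threshold on `h₁` separates the two cases. If it
vanishes, only `|t|` is recovered and the sign may restart. Either way the block error grows by a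
factor at most `K` (`exists_sign_of_extension`).

Sign restarts do no harm: they occur only where `c` vanishes on the whole side already
reconstructed. So `forward_induction` and `backward_induction` give one sign per extended block and
the error `N B K^(N-1+h) √(8E)`. Consecutive extended blocks overlap in exactly one window of length
`N-1`. Where that window has energy, a nonnegative inner product forces equal signs; elsewhere `c`
vanishes on one side and no comparison is needed (`sewing`). -/

/-! ### The Euclidean norm of finite real vectors -/

/-- The Euclidean norm of a finite real vector. -/
def nrm {ι : Type*} [Fintype ι] (w : ι → ℝ) : ℝ := ‖WithLp.toLp 2 w‖

section nrm

variable {ι : Type*} [Fintype ι] (u w : ι → ℝ)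

theorem nrm_nonneg : 0 ≤ nrm u := norm_nonneg _

theorem nrm_sq : nrm u ^ 2 = ∑ n, u n ^ 2 := by
  simp [nrm, EuclideanSpace.norm_sq_eq]

theorem nrm_add_le : nrm (u + w) ≤ nrm u + nrm w := norm_add_le _ _

theorem nrm_sub_le : nrm (u - w) ≤ nrm u + nrm w := norm_sub_le _ _

theorem nrm_smul (a : ℝ) : nrm (a • u) = |a| * nrm u := norm_smul a (WithLp.toLp 2 u)

theorem nrm_sub_rev : nrm (u - w) = nrm (w - u) := norm_sub_rev (WithLp.toLp 2 u) (WithLp.toLp 2 w)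

theorem nrm_zero : nrm (0 : ι → ℝ) = 0 := norm_zero (E := EuclideanSpace ℝ ι)

theorem nrm_eq_zero : nrm u = 0 ↔ u = 0 := by
  rw [nrm, norm_eq_zero]
  exact ⟨fun h => by simpa using congrArg WithLp.ofLp h, fun h => by rw [h]; rfl⟩

variable {u w}

theorem nrm_le_of_sq_le {b : ℝ} (hb : 0 ≤ b) (h : ∑ n, u n ^ 2 ≤ b ^ 2) : nrm u ≤ b :=
  le_of_sq_le_sq (by rw [nrm_sq]; exact h) hb

theorem nrm_mono (h : ∀ n, |u n| ≤ |w n|) : nrm u ≤ nrm w := by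
  refine nrm_le_of_sq_le (nrm_nonneg w) ?_
  rw [nrm_sq]
  exact Finset.sum_le_sum fun n _ => sq_le_sq.2 (h n)

theorem abs_apply_le_nrm (u : ι → ℝ) (n : ι) : |u n| ≤ nrm u := by
  refine abs_le_of_sq_le_sq ?_ (nrm_nonneg u)
  rw [nrm_sq]
  exact Finset.single_le_sum (f := fun n => u n ^ 2) (fun _ _ => sq_nonneg _) (Finset.mem_univ n)

theorem nrm_le_of_abs_le {b : ℝ} (hb : 0 ≤ b) (h : ∀ n, |u n| ≤ b) :
    nrm u ≤ √(Fintype.card ι) * b := by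
  refine nrm_le_of_sq_le (by positivity) ?_
  rw [mul_pow, Real.sq_sqrt (by positivity)]
  calc ∑ n, u n ^ 2 ≤ ∑ _n : ι, b ^ 2 :=
        Finset.sum_le_sum fun n _ => sq_le_sq.2 (by rw [abs_of_nonneg hb]; exact h n)
    _ = _ := by simp

theorem abs_sum_mul_le (u w : ι → ℝ) : |∑ n, u n * w n| ≤ nrm u * nrm w := by
  have := abs_real_inner_le_norm (WithLp.toLp 2 u) (WithLp.toLp 2 w)
  simpa [nrm, PiLp.inner_apply, mul_comm] using this

theorem nrm_mul_le (u w : ι → ℝ) : nrm (u * w) ≤ nrm u * nrm w := by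
  calc nrm (u * w) ≤ nrm (nrm u • w) := nrm_mono fun n => by
        simp only [Pi.mul_apply, Pi.smul_apply, smul_eq_mul, abs_mul, abs_of_nonneg (nrm_nonneg u)]
        exact mul_le_mul_of_nonneg_right (abs_apply_le_nrm u n) (abs_nonneg _)
    _ = nrm u * nrm w := by rw [nrm_smul, abs_of_nonneg (nrm_nonneg u)]

theorem nrm_update_zero_le_update [DecidableEq ι] (u : ι → ℝ) (i : ι) (s : ℝ) :
    nrm (Function.update u i 0) ≤ nrm (Function.update u i s) := nrm_mono fun n => by
  by_cases h : n = i
  · subst h; simp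
  · simp [h]

end nrm

/-! ### Projection onto the orthogonal complement of a vector -/

/-- The component of `e` orthogonal to `v`. -/
def orth {N : ℕ} (v e : Fin N → ℝ) : Fin N → ℝ :=
  e - ((∑ n, v n * e n) / ∑ n, v n ^ 2) • v

section orth

variable {N : ℕ} {v : Fin N → ℝ}

theorem sum_mul_orth (hv : ∑ n, v n ^ 2 ≠ 0) (e : Fin N → ℝ) : ∑ n, v n * orth v e n = 0 := by
  have : ∀ n, v n * orth v e n = v n * e n - ((∑ n, v n * e n) / ∑ n, v n ^ 2) * v n ^ 2 := by
    intro n; simp only [orth, Pi.sub_apply, Pi.smul_apply, smul_eq_mul]; ring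
  simp only [this, Finset.sum_sub_distrib, ← Finset.mul_sum]
  field_simp
  ring

theorem nrm_orth_sq (hv : ∑ n, v n ^ 2 ≠ 0) (e : Fin N → ℝ) :
    nrm (orth v e) ^ 2 = ∑ n, e n * orth v e n := by
  rw [nrm_sq]
  have : ∀ n, orth v e n ^ 2 = e n * orth v e n
      - ((∑ n, v n * e n) / ∑ n, v n ^ 2) * (v n * orth v e n) := by
    intro n
    rw [sq]
    nth_rw 1 [orth]
    simp only [Pi.sub_apply, Pi.smul_apply, smul_eq_mul]
    ring
  simp only [this, Finset.sum_sub_distrib, ← Finset.mul_sum, sum_mul_orth hv]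
  ring

/-- A Gram determinant of two vectors, divided by the squared norm of the first, is the squared
distance of the second from the line through the first. -/
theorem h1_eq (hv : ∑ n, v n ^ 2 ≠ 0) (e : Fin N → ℝ) : h1 v e = nrm (orth v e) ^ 2 := by
  rw [nrm_orth_sq hv]
  have : ∀ n, e n * orth v e n = e n ^ 2 - ((∑ n, v n * e n) / ∑ n, v n ^ 2) * (v n * e n) := by
    intro n; simp only [orth, Pi.sub_apply, Pi.smul_apply, smul_eq_mul]; ring
  simp only [this, Finset.sum_sub_distrib, ← Finset.mul_sum, h1, Matrix.det_fin_two_of, sq_abs]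
  field_simp

theorem h2_eq (hv : ∑ n, v n ^ 2 ≠ 0) (hv' : ∀ n, v n ≠ 0) (e₁ e₂ : Fin N → ℝ) :
    h2 v e₁ e₂ = ∑ n, e₂ n / v n * orth v e₁ n := by
  have : ∀ n, e₂ n / v n * orth v e₁ n =
      e₁ n * e₂ n / v n - ((∑ n, v n * e₁ n) / ∑ n, v n ^ 2) * e₂ n := by
    intro n; simp only [orth, Pi.sub_apply, Pi.smul_apply, smul_eq_mul]
    field_simp [hv' n]
  simp only [this, Finset.sum_sub_distrib, ← Finset.mul_sum, h2, Matrix.det_fin_two_of, sq_abs]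
  field_simp

theorem orth_add (e e' : Fin N → ℝ) : orth v (e + e') = orth v e + orth v e' := by
  ext n
  simp only [orth, Pi.add_apply, Pi.sub_apply, Pi.smul_apply, smul_eq_mul, mul_add,
    Finset.sum_add_distrib]
  ring

theorem nrm_orth_le (hv : ∑ n, v n ^ 2 ≠ 0) (e : Fin N → ℝ) : nrm (orth v e) ≤ nrm e := by
  have h : nrm (orth v e) ^ 2 ≤ nrm e * nrm (orth v e) := by
    rw [nrm_orth_sq hv]
    exact (le_abs_self _).trans (abs_sum_mul_le _ _)
  by_contra! hlt
  nlinarith [nrm_nonneg e]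

end orth

/-! ### Stability of a single extension step -/

/-- The noisy sample `b` may be negative. The convention `√b = 0` then only helps, because `b ≤
(√b)²` holds in every case. -/
theorem abs_sqrt_sub_abs_le {a b E : ℝ} (h : |b - a ^ 2| ≤ E) : |(√b - |a|)| ≤ √E := by
  have hE : 0 ≤ E := (abs_nonneg _).trans h
  rw [abs_le] at h ⊢
  have hs := Real.sq_sqrt hE
  have ha := sq_abs a
  have h0 := Real.sqrt_nonneg E
  constructor
  · by_contra! hlt
    have hb0 := Real.sqrt_nonneg b
    have hb : b ≤ √b ^ 2 := by
      rcases le_total 0 b with hb | hb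
      · rw [Real.sq_sqrt hb]
      · exact hb.trans (sq_nonneg _)
    nlinarith
  · have : √b ≤ |a| + √E := by
      rw [Real.sqrt_le_left (by positivity)]
      nlinarith [abs_nonneg a]
    linarith

/-- A wrong sign is cheap: if `g` and `f` do not have the same sign, then `|f| ≤ |g - f|`, so the
sample is already small on the scale of the prediction error. -/
theorem abs_sign_mul_sub_le {f g s r : ℝ} (hs : 0 ≤ s) (h : |(s - |f|)| ≤ r) :
    |Real.sign g * s - f| ≤ 2 * |g - f| + r := by
  have hr := (abs_nonneg _).trans h
  rw [abs_le] at h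
  rcases lt_trichotomy g 0 with hg | hg | hg <;> rcases le_or_gt 0 f with hf | hf
  all_goals
    first
    | rw [Real.sign_of_neg hg]
    | rw [Real.sign_of_pos hg]
    | rw [hg, Real.sign_zero]
    first
    | rw [abs_of_nonneg hf] at h
    | rw [abs_of_neg hf] at h
    rw [abs_le]
    constructor <;> cases abs_cases (g - f) <;> cases abs_cases (0 - f) <;> linarith

variable {N : ℕ}

/-- The prediction error of the new coefficient. -/
theorem predicted_sub (v α f : Fin N → ℝ) (z : ℝ → ℝ) (y : Fin N → ℝ) (t : ℝ)
    (hv : ∑ n, v n ^ 2 ≠ 0) (hv' : ∀ n, v n ≠ 0) (hα : nrm (orth v α) ≠ 0) :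
    predicted v α z y - t =
      (∑ n, (z (y n) - f n ^ 2
        - (α n - (f n - t * v n)) * (2 * f n + (α n - (f n - t * v n)))) / v n * orth v α n) /
        (2 * nrm (orth v α) ^ 2) := by
  -- With `a = α - (f - t v)`, expanding `(f + a)² = (α + t v)²` writes `z - α²` as `2tαv + t²v²`
  -- plus an error. After division by `v` the quadratic term is a multiple of `v`, which is
  -- orthogonal to `orth v α`.
  have key : ∑ n, (z (y n) - |α n| ^ 2) / v n * orth v α n =
      2 * t * nrm (orth v α) ^ 2 + ∑ n, (z (y n) - f n ^ 2
        - (α n - (f n - t * v n)) * (2 * f n + (α n - (f n - t * v n)))) / v n * orth v α n := by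
    have h0 := sum_mul_orth hv α
    have h1 := nrm_orth_sq hv α
    have : ∀ n, (z (y n) - |α n| ^ 2) / v n * orth v α n =
        2 * t * (α n * orth v α n) + t ^ 2 * (v n * orth v α n) + (z (y n) - f n ^ 2
        - (α n - (f n - t * v n)) * (2 * f n + (α n - (f n - t * v n)))) / v n * orth v α n := by
      intro n
      rw [sq_abs]
      field_simp [hv' n]
      ring
    simp only [this, Finset.sum_add_distrib, ← Finset.mul_sum, h0, h1]
    ring
  rw [predicted, h2_eq hv hv', h1_eq hv, key]
  field_simp
  ring

section step

variable {N : ℕ} {G : Matrix (Fin N) (Fin N) ℝ} {A B μ : ℝ}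

theorem mulVec_update (G : Matrix (Fin N) (Fin N) ℝ) (i : Fin N) (u : Fin N → ℝ) (s : ℝ) :
    G *ᵥ Function.update u i s = G *ᵥ Function.update u i 0 + s • fun n => G n i := by
  have : Function.update u i s = Function.update u i 0 + Pi.single i s := by
    ext j
    by_cases h : j = i
    · subst h; simp
    · simp [h]
  rw [this, mulVec_add]
  congr 1
  ext n
  simp [mulVec_single, mul_comm]

theorem mulVec_eq_add (G : Matrix (Fin N) (Fin N) ℝ) (i : Fin N) (u : Fin N → ℝ) :
    G *ᵥ u = G *ᵥ Function.update u i 0 + u i • fun n => G n i := by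
  rw [← mulVec_update, Function.update_eq_self]

theorem sum_sq_col_pos (hμ : 0 < μ) {i : Fin N} (hv : ∀ n, μ ≤ |G n i|) :
    0 < ∑ n, G n i ^ 2 := by
  have : Nonempty (Fin N) := ⟨i⟩
  refine Finset.sum_pos (fun n _ => ?_) Finset.univ_nonempty
  have := hμ.trans_le (hv n)
  rw [← sq_abs]
  positivity

/-- The distance of the known part of the samples from the span of the new column. -/
theorem nrm_update_le_orth (hB : ∀ w, nrm w ≤ B * nrm (G *ᵥ w))
    (i : Fin N) (u : Fin N → ℝ) :
    nrm (Function.update u i 0) ≤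
      B * nrm (orth (fun n => G n i) (G *ᵥ Function.update u i 0)) := by
  set s := (∑ n, G n i * (G *ᵥ Function.update u i 0) n) / ∑ n, G n i ^ 2 with hs
  -- The residual of the projection is itself an image under `G`, of the vector with entry `-s` at
  -- `i`. The lower bound for `G` applies, and zeroing an entry does not increase the norm.
  have : orth (fun n => G n i) (G *ᵥ Function.update u i 0) =
      G *ᵥ Function.update u i (-s) := by
    rw [mulVec_update G i u (-s), orth, neg_smul, sub_eq_add_neg]
  rw [this]
  exact (nrm_update_zero_le_update u i (-s)).trans (hB _)

/-- Projection is linear and contractive, so replacing the true window by the reconstructed one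
costs at most `A e`. -/
theorem nrm_orth_lower (hA : ∀ w, nrm (G *ᵥ w) ≤ A * nrm w)
    (hB : ∀ w, nrm w ≤ B * nrm (G *ᵥ w)) (hB0 : 0 < B) {i : Fin N}
    (hv : ∑ n, G n i ^ 2 ≠ 0) {u u' : Fin N → ℝ} {e : ℝ} (hA0 : 0 ≤ A)
    (he : nrm (Function.update u' i 0 - Function.update u i 0) ≤ e) :
    nrm (Function.update u i 0) ≤
      B * (nrm (orth (fun n => G n i) (G *ᵥ Function.update u' i 0)) + A * e) := by
  refine (nrm_update_le_orth hB i u).trans (mul_le_mul_of_nonneg_left ?_ hB0.le)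
  have h1 : G *ᵥ Function.update u i 0 = G *ᵥ Function.update u' i 0
      + G *ᵥ (Function.update u i 0 - Function.update u' i 0) := by
    rw [← mulVec_add, add_sub_cancel]
  rw [h1, orth_add]
  refine (nrm_add_le _ _).trans (add_le_add_right ?_ _)
  refine (nrm_orth_le hv _).trans ((hA _).trans ?_)
  rw [nrm_sub_rev]
  exact mul_le_mul_of_nonneg_left he hA0

set_option maxHeartbeats 1000000 in
/-- The extension step in the presence of enough energy in the known window. -/
theorem nrm_sub_le_of_system (hA : ∀ w, nrm (G *ᵥ w) ≤ A * nrm w)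
    (hB : ∀ w, nrm w ≤ B * nrm (G *ᵥ w)) (hA0 : 0 < A) (hB0 : 0 < B) (hAB : 1 ≤ A * B)
    (hμ : 0 < μ) (hμA : μ ≤ A) {i : Fin N} (hv : ∀ n, μ ≤ |G n i|)
    {u u' u'' : Fin N → ℝ} {z : ℝ → ℝ} {y : Fin N → ℝ} {e E W M : ℝ} (hM : 1 ≤ M)
    (hz : ∀ n, |z (y n) - (G *ᵥ u) n ^ 2| ≤ E) (hE : 0 ≤ E)
    (hW0 : 0 < W) (hW : W ≤ nrm (Function.update u i 0))
    (huM : nrm u ≤ M * W)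
    (he : nrm (Function.update u' i 0 - Function.update u i 0) ≤ e)
    (heW : 4 * (A * B) * e ≤ W) (hEe : 8 * N * E * B ^ 2 ≤ e ^ 2)
    (hu'' : ∀ n, (G *ᵥ u'') n =
      signedSample (fun n => G n i) (G *ᵥ Function.update u' i 0) z y n) :
    nrm (u'' - u) ≤ 11 * (A ^ 4 * B ^ 3 * M / μ) * e := by
  have hN : Nonempty (Fin N) := ⟨i⟩
  have hN1 : (1 : ℝ) ≤ N := by exact_mod_cast Nat.succ_le_of_lt (Fin.pos i)
  have he0 : 0 ≤ e := (nrm_nonneg _).trans he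
  have hvs := (sum_sq_col_pos hμ hv).ne'
  have hv' : ∀ n, G n i ≠ 0 := fun n => abs_pos.1 (hμ.trans_le (hv n))
  set v : Fin N → ℝ := fun n => G n i with hvdef
  set α := G *ᵥ Function.update u' i 0 with hα
  set f := G *ᵥ u with hf
  set a := α - G *ᵥ Function.update u i 0 with ha
  set d := predicted v α z y with hd
  have hnv : nrm v ≤ A := by
    have h1 : v = G *ᵥ Pi.single i 1 := by ext n; simp [hvdef]
    have h2 : nrm (Pi.single i (1 : ℝ) : Fin N → ℝ) ≤ 1 := by
      refine nrm_le_of_sq_le zero_le_one ?_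
      simp [Pi.single_apply]
    rw [h1]
    calc _ ≤ _ := hA _
      _ ≤ A * 1 := mul_le_mul_of_nonneg_left h2 hA0.le
      _ = A := mul_one A
  have hna : nrm a ≤ A * e := by
    rw [ha, hα, ← mulVec_sub]
    exact (hA _).trans (mul_le_mul_of_nonneg_left he hA0.le)
  have hfa : ∀ n, f n - u i * v n = α n - a n := by
    intro n
    rw [hf, mulVec_eq_add G i u]
    simp [ha, hvdef]
  have heW' : e ≤ W := by nlinarith
  -- The assumption `4ABe ≤ W` lets the perturbation consume at most a quarter of the window norm.
  have hP : 3 / 4 * W ≤ B * nrm (orth v α) := by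
    have := hW.trans (nrm_orth_lower hA hB hB0 hvs hA0.le he)
    rw [← hα] at this
    nlinarith
  have hP0 : 0 < nrm (orth v α) := by
    by_contra! h
    nlinarith
  -- the right-hand side of the formula for the prediction error
  set r : Fin N → ℝ := fun n => z (y n) - f n ^ 2 - a n * (2 * f n + a n) with hr
  have hpred : d - u i = (∑ n, r n / v n * orth v α n) / (2 * nrm (orth v α) ^ 2) := by
    rw [hd, predicted_sub v α f z y (u i) hvs hv' hP0.ne']
    simp only [hfa, sub_sub_cancel, hr]
  have hnf : nrm f ≤ A * (M * W) := (hA u).trans (mul_le_mul_of_nonneg_left huM hA0.le)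
  have hnr : nrm r ≤ 4 * A ^ 2 * M * e * W := by
    have h1 : r = (fun n => z (y n) - f n ^ 2) - ((2 : ℝ) • (a * f) + a * a) := by
      ext n
      simp [hr]
      ring
    have h2 : nrm (fun n => z (y n) - f n ^ 2) ≤ N * E := by
      refine (nrm_le_of_abs_le hE hz).trans (mul_le_mul_of_nonneg_right ?_ hE)
      rw [Fintype.card_fin, Real.sqrt_le_left (by positivity)]
      nlinarith
    have h3 : nrm (a * f) ≤ A * e * (A * (M * W)) :=
      (nrm_mul_le _ _).trans (mul_le_mul hna hnf (nrm_nonneg _) (by positivity))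
    have h4 : nrm (a * a) ≤ A * e * (A * e) :=
      (nrm_mul_le _ _).trans (mul_le_mul hna hna (nrm_nonneg _) (by positivity))
    have h5 : nrm r ≤ N * E + (2 * (A * e * (A * (M * W))) + A * e * (A * e)) := by
      rw [h1]
      refine (nrm_sub_le _ _).trans (add_le_add h2 ((nrm_add_le _ _).trans (add_le_add ?_ h4)))
      rw [nrm_smul, abs_two]
      linarith
    have h6 : N * E ≤ A ^ 2 * (e * W) := by
      have hc : 0 ≤ N * E := by positivity
      have : N * E * 1 ≤ N * E * (A * B) ^ 2 :=
        mul_le_mul_of_nonneg_left (one_le_pow₀ hAB) hc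
      have h7 : A ^ 2 * (8 * N * E * B ^ 2) ≤ A ^ 2 * e ^ 2 :=
        mul_le_mul_of_nonneg_left hEe (by positivity)
      have h8 : A ^ 2 * e ^ 2 ≤ A ^ 2 * (e * W) :=
        mul_le_mul_of_nonneg_left (by nlinarith) (by positivity)
      have h9 : A ^ 2 * (8 * N * E * B ^ 2) = 8 * (N * E * (A * B) ^ 2) := by ring
      linarith
    have h9 : A ^ 2 * (e * W) ≤ A ^ 2 * (e * W) * M :=
      le_mul_of_one_le_right (by positivity) hM
    have h10 : A * e * (A * e) ≤ A ^ 2 * (e * W) := by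
      calc A * e * (A * e) = A ^ 2 * (e * e) := by ring
        _ ≤ A ^ 2 * (e * W) := by gcongr
    have h11 : A * e * (A * (M * W)) = A ^ 2 * (e * W) * M := by ring
    calc nrm r ≤ 4 * (A ^ 2 * (e * W) * M) := by linarith
      _ = _ := by ring
  -- Dividing by `v` costs `1/μ`. One factor `‖orth v α‖` cancels, and the other absorbs `W ≤
  -- 2B‖orth v α‖`.
  have hdu : |d - u i| ≤ 4 * (A ^ 2 * B * M / μ) * e := by
    have h1 : |∑ n, r n / v n * orth v α n| ≤ nrm r / μ * nrm (orth v α) := by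
      refine (abs_sum_mul_le (fun n => r n / v n) _).trans
        (mul_le_mul_of_nonneg_right ?_ hP0.le)
      have : nrm (fun n => r n / v n) ≤ nrm (μ⁻¹ • r) := nrm_mono fun n => by
        simp only [Pi.smul_apply, smul_eq_mul, abs_mul, abs_div, abs_of_pos (inv_pos.2 hμ)]
        rw [div_eq_mul_inv, mul_comm]
        exact mul_le_mul_of_nonneg_right (inv_anti₀ hμ (hv n)) (abs_nonneg _)
      rw [nrm_smul, abs_of_pos (inv_pos.2 hμ)] at this
      rwa [div_eq_inv_mul]
    rw [hpred, abs_div, abs_of_pos (by positivity : 0 < 2 * nrm (orth v α) ^ 2),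
      div_le_iff₀ (by positivity)]
    refine h1.trans ?_
    have h2 : nrm r ≤ 4 * A ^ 2 * M * e * (2 * (B * nrm (orth v α))) :=
      hnr.trans (mul_le_mul_of_nonneg_left (by linarith) (by positivity))
    calc nrm r / μ * nrm (orth v α)
        ≤ (4 * A ^ 2 * M * e * (2 * (B * nrm (orth v α)))) / μ * nrm (orth v α) := by gcongr
      _ = _ := by ring
  -- `T` is the common unit of error: the prediction is off by at most `5T`, the signs double this,
  -- and noise adds one more `T`, which gives the constant `11`.
  set T := A ^ 3 * B * M / μ * e with hT
  have hAT : A * e ≤ T := by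
    have : 1 ≤ A ^ 2 * B * M / μ := by
      rw [le_div_iff₀ hμ, one_mul]
      calc μ ≤ A * 1 * 1 := by linarith
        _ ≤ A * (A * B) * M := by gcongr
        _ = _ := by ring
    calc A * e ≤ A * e * (A ^ 2 * B * M / μ) := le_mul_of_one_le_right (by positivity) this
      _ = T := by rw [hT]; ring
  -- the error of the signed samples
  have hgf : nrm ((α + d • v) - f) ≤ 5 * T := by
    have h1 : (α + d • v) - f = a + (d - u i) • v := by
      ext n
      have := hfa n
      simp only [Pi.sub_apply, Pi.add_apply, Pi.smul_apply, smul_eq_mul]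
      linarith
    rw [h1]
    refine (nrm_add_le _ _).trans ?_
    rw [nrm_smul]
    have h2 : |d - u i| * nrm v ≤ 4 * (A ^ 2 * B * M / μ) * e * A :=
      mul_le_mul hdu hnv (nrm_nonneg _) (by positivity)
    have h3 : 4 * (A ^ 2 * B * M / μ) * e * A = 4 * T := by rw [hT]; ring
    linarith
  have hsE : √N * √E ≤ A * e := by
    rw [← Real.sqrt_mul (by positivity)]
    refine Real.sqrt_le_iff.2 ⟨by positivity, ?_⟩
    have : N * E * 1 ≤ N * E * (A * B) ^ 2 :=
      mul_le_mul_of_nonneg_left (one_le_pow₀ hAB) (by positivity)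
    have h7 : A ^ 2 * (8 * N * E * B ^ 2) ≤ A ^ 2 * e ^ 2 :=
      mul_le_mul_of_nonneg_left hEe (by positivity)
    have h9 : A ^ 2 * (8 * N * E * B ^ 2) = 8 * (N * E * (A * B) ^ 2) := by ring
    have h10 : 0 ≤ N * E := by positivity
    rw [mul_pow]
    linarith
  have hss : nrm (G *ᵥ u'' - f) ≤ 11 * T := by
    set g := (α + d • v) - f with hg
    have h1 : nrm (G *ᵥ u'' - f) ≤ nrm ((2 : ℝ) • (fun n => |g n|) + fun _ => √E) := by
      refine nrm_mono fun n => ?_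
      have h2 := abs_sign_mul_sub_le (g := (α + d • v) n) (f := f n) (Real.sqrt_nonneg (z (y n)))
        (abs_sqrt_sub_abs_le (hz n))
      have h3 : (G *ᵥ u'') n = Real.sign ((α + d • v) n) * √(z (y n)) := hu'' n
      rw [Pi.sub_apply, h3]
      exact h2.trans (le_abs_self _)
    have h4 : nrm (fun n => |g n|) ≤ nrm g := nrm_mono fun n => by rw [abs_abs]
    have h5 : nrm (fun _ : Fin N => √E) ≤ √N * √E := by
      have := nrm_le_of_abs_le (u := fun _ : Fin N => √E) (Real.sqrt_nonneg E)
        (fun _ => by rw [abs_of_nonneg (Real.sqrt_nonneg E)])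
      rwa [Fintype.card_fin] at this
    have h6 := nrm_add_le ((2 : ℝ) • (fun n => |g n|)) (fun _ => √E)
    rw [nrm_smul, abs_two] at h6
    linarith
  calc nrm (u'' - u) ≤ B * nrm (G *ᵥ u'' - f) := by rw [hf, ← mulVec_sub]; exact hB _
    _ ≤ B * (11 * T) := mul_le_mul_of_nonneg_left hss hB0.le
    _ = 11 * (A ^ 3 * B ^ 2 * M / μ * e) := by rw [hT]; ring
    -- The spare factor `AB ≥ 1` only brings the bound to the shape of `C_{f,φ}`.
    _ ≤ 11 * (A ^ 3 * B ^ 2 * M / μ * e * (A * B)) :=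
        mul_le_mul_of_nonneg_left (le_mul_of_one_le_right (by positivity) hAB) (by norm_num)
    _ = _ := by ring

/-- The least squares value determines the modulus of the new coefficient if the known window
vanishes. -/
theorem abs_lsqValue_sub_le {v : Fin N → ℝ} {z : ℝ → ℝ} {y : Fin N → ℝ} {t E : ℝ}
    (hμ : 0 < μ) (hv : ∀ n, μ ≤ |v n|) (hN : 0 < N)
    (hz : ∀ n, |z (y n) - (t * v n) ^ 2| ≤ E) :
    |(lsqValue v z y - |t|)| ≤ √E / μ := by
  have : Nonempty (Fin N) := ⟨⟨0, hN⟩⟩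
  have hpos : 0 < ∑ n, |v n| ^ 2 := Finset.sum_pos
    (fun n _ => pow_pos (hμ.trans_le (hv n)) 2) Finset.univ_nonempty
  -- As `|t v| = |t| |v|`, the error of the least squares value is linear in the errors of the
  -- moduli.
  have h1 : lsqValue v z y - |t| = (∑ n, |v n| * (√(z (y n)) - |t * v n|)) / ∑ n, |v n| ^ 2 := by
    rw [lsqValue, eq_div_iff hpos.ne', sub_mul, div_mul_cancel₀ _ hpos.ne', Finset.mul_sum,
      ← Finset.sum_sub_distrib]
    refine Finset.sum_congr rfl fun n _ => ?_
    rw [abs_mul]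
    ring
  rw [h1, abs_div, abs_of_pos hpos, div_le_iff₀ hpos, Finset.mul_sum]
  refine (Finset.abs_sum_le_sum_abs _ _).trans (Finset.sum_le_sum fun n _ => ?_)
  rw [abs_mul, abs_abs]
  have h2 := abs_sqrt_sub_abs_le (hz n)
  have h3 : μ * √E ≤ |v n| * √E := mul_le_mul_of_nonneg_right (hv n) (Real.sqrt_nonneg _)
  calc |v n| * |(√(z (y n)) - |t * v n|)| ≤ |v n| * √E :=
        mul_le_mul_of_nonneg_left h2 (abs_nonneg _)
    _ ≤ √E / μ * |v n| ^ 2 := by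
        rw [div_mul_eq_mul_div, le_div_iff₀ hμ]
        nlinarith [abs_nonneg (v n)]

end step

/-! ### Norm bounds for the sampling matrix -/

theorem nrm_mulVec_le {m n : ℕ} (Ψ : Matrix (Fin m) (Fin n) ℝ) (w : Fin n → ℝ) :
    nrm (Ψ *ᵥ w) ≤ opNorm Ψ * nrm w := by
  have := (LinearMap.toContinuousLinearMap (Matrix.toEuclideanLin Ψ)).le_opNorm (WithLp.toLp 2 w)
  simpa [nrm, opNorm, Matrix.toLpLin_apply] using this

theorem nrm_comp_le {ι κ : Type*} [Fintype ι] [Fintype κ] {g : ι → κ}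
    (hg : Function.Injective g) (w : κ → ℝ) : nrm (fun n => w (g n)) ≤ nrm w := by
  classical
  refine nrm_le_of_sq_le (nrm_nonneg w) ?_
  rw [nrm_sq, ← Finset.sum_image (f := fun k => w k ^ 2) (fun a _ b _ h => hg h)]
  exact Finset.sum_le_sum_of_subset_of_nonneg (Finset.subset_univ _) fun _ _ _ => sq_nonneg _

theorem nrm_comp_eq_of_range_eq {ι κ : Type*} [Fintype ι] [Fintype κ] {g g' : ι → κ}
    (hg : Function.Injective g) (hg' : Function.Injective g')
    (h : Set.range g = Set.range g') (w : κ → ℝ) :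
    nrm (fun n => w (g n)) = nrm (fun n => w (g' n)) := by
  classical
  rw [← sq_eq_sq₀ (nrm_nonneg _) (nrm_nonneg _), nrm_sq, nrm_sq,
    ← Finset.sum_image (f := fun k => w k ^ 2) (fun a _ b _ h => hg h),
    ← Finset.sum_image (f := fun k => w k ^ 2) (fun a _ b _ h => hg' h)]
  congr 1
  rw [← Finset.coe_inj]
  simpa using h

/-- `normInv` runs over increasing row selections, whereas the points `γ` come in any order. Sorting
the rows leaves the Euclidean norm unchanged. -/
theorem nrm_le_normInv {φ : ℝ → ℝ} {N : ℕ} {x : Fin (2 * N - 1) → ℝ} (hspark : FullSpark φ N x)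
    {g : Fin N → Fin (2 * N - 1)} (hg : Function.Injective g) (w : Fin N → ℝ) :
    nrm w ≤ normInv φ N x * nrm (fun n => (Phi φ N x *ᵥ w) (g n)) := by
  classical
  have hcard : (Finset.univ.image g).card = N := by
    rw [Finset.card_image_of_injective _ hg, Finset.card_univ, Fintype.card_fin]
  set s := (Finset.univ.image g).orderEmbOfFin hcard with hs
  have hr : Set.range g = Set.range s := by
    rw [hs, Finset.range_orderEmbOfFin]; simp
  rw [nrm_comp_eq_of_range_eq hg s.injective hr]
  have h1 : w = (PhiSub φ N x s)⁻¹ *ᵥ (PhiSub φ N x s *ᵥ w) := by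
    rw [mulVec_mulVec, nonsing_inv_mul _ (isUnit_iff_ne_zero.2 (hspark s)), one_mulVec]
  have h2 : opNorm (PhiSub φ N x s)⁻¹ ≤ normInv φ N x := by
    have : Finite (Fin N ↪o Fin (2 * N - 1)) := DFunLike.finite _
    exact le_ciSup (f := fun s : Fin N ↪o Fin (2 * N - 1) => opNorm (PhiSub φ N x s)⁻¹)
      (Set.finite_range _).bddAbove s
  calc nrm w = nrm ((PhiSub φ N x s)⁻¹ *ᵥ (PhiSub φ N x s *ᵥ w)) := by rw [← h1]
    _ ≤ opNorm (PhiSub φ N x s)⁻¹ * nrm (PhiSub φ N x s *ᵥ w) := nrm_mulVec_le _ _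
    _ ≤ _ := mul_le_mul_of_nonneg_right h2 (nrm_nonneg _)

/-- Two-sided bounds for the square row selections of a matrix, together with the normalizations
used in the error estimates. -/
structure StableBounds {N : ℕ} (Ψ : Matrix (Fin (2 * N - 1)) (Fin N) ℝ) (A B μ : ℝ) : Prop where
  A_pos : 0 < A
  B_pos : 0 < B
  one_le : 1 ≤ A * B
  μ_pos : 0 < μ
  μ_le : μ ≤ A
  upper : ∀ g : Fin N → Fin (2 * N - 1), Function.Injective g → ∀ w : Fin N → ℝ,
    nrm (Ψ.submatrix g id *ᵥ w) ≤ A * nrm w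
  lower : ∀ g : Fin N → Fin (2 * N - 1), Function.Injective g → ∀ w : Fin N → ℝ,
    nrm w ≤ B * nrm (Ψ.submatrix g id *ᵥ w)

/-- One entry of modulus at least `μ` bounds `A` from below, and testing the two-sided bound on a
unit vector gives `1 ≤ AB`. -/
theorem stableBounds_phi {φ : ℝ → ℝ} {N : ℕ} {x : Fin (2 * N - 1) → ℝ}
    (hspark : FullSpark φ N x) {g : Fin N → Fin (2 * N - 1)} (hg : Function.Injective g)
    (i : Fin N) {μ : ℝ} (hμ : 0 < μ) (hμi : μ ≤ |Phi φ N x (g i) i|) :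
    StableBounds (Phi φ N x) (opNorm (Phi φ N x)) (normInv φ N x) μ := by
  set A := opNorm (Phi φ N x)
  set B := normInv φ N x
  have h1 : nrm (Pi.single i (1 : ℝ) : Fin N → ℝ) = 1 := by
    rw [← sq_eq_sq₀ (nrm_nonneg _) zero_le_one, nrm_sq]
    simp [Pi.single_apply]
  have hA : μ ≤ A := by
    have h2 := nrm_mulVec_le (Phi φ N x) (Pi.single i 1)
    rw [h1, mul_one] at h2
    refine hμi.trans (le_trans ?_ h2)
    simpa using abs_apply_le_nrm (Phi φ N x *ᵥ Pi.single i 1) (g i)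
  have hA0 := hμ.trans_le hA
  have hlow := fun w => nrm_le_normInv hspark hg w
  have hup := fun (g : Fin N → Fin (2 * N - 1)) (hg : Function.Injective g) w =>
    (nrm_comp_le hg (Phi φ N x *ᵥ w)).trans (nrm_mulVec_le _ _)
  have hB0 : 0 < B := by
    have h2 := hlow (Pi.single i 1)
    rw [h1] at h2
    by_contra! h
    have := mul_nonpos_of_nonpos_of_nonneg h
      (nrm_nonneg (fun n => (Phi φ N x *ᵥ Pi.single i 1) (g n)))
    linarith
  refine ⟨hA0, hB0, ?_, hμ, hA, fun g hg w => hup g hg w,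
    fun g hg w => nrm_le_normInv hspark hg w⟩
  have h2 := hlow (Pi.single i 1)
  have h3 := mul_le_mul_of_nonneg_left (hup g hg (Pi.single i 1)) hB0.le
  rw [h1] at h2 h3
  linarith

/-! ### Blocks of coefficients -/

/-- The coefficients `w(p), w(p-1), ..., w(p-N+1)`. -/
def blk (N : ℕ) (w : ℤ → ℝ) (p : ℤ) : Fin N → ℝ := fun n => w (p - (n : ℕ))

theorem sum_blk (N : ℕ) (F : ℤ → ℝ) (p : ℤ) :
    ∑ n : Fin N, F (p - (n : ℕ)) = ∑ j ∈ Finset.Icc (p - N + 1) p, F j := by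
  refine Finset.sum_bij (fun n _ => p - (n : ℕ)) ?_ ?_ ?_ ?_
  · intro n _
    have := n.2
    simp only [Finset.mem_Icc]
    omega
  · intro n _ m _ h
    have h' : p - ((n : ℕ) : ℤ) = p - ((m : ℕ) : ℤ) := h
    exact Fin.ext (by omega)
  · intro j hj
    simp only [Finset.mem_Icc] at hj
    exact ⟨⟨(p - j).toNat, by omega⟩, Finset.mem_univ _, by simp only; omega⟩
  · intro n _
    rfl

theorem nrm_blk_sq (N : ℕ) (w : ℤ → ℝ) (p : ℤ) :
    nrm (blk N w p) ^ 2 = ∑ j ∈ Finset.Icc (p - N + 1) p, w j ^ 2 := by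
  rw [nrm_sq, ← sum_blk]
  rfl

theorem blk_update (N : ℕ) (w : ℤ → ℝ) (p : ℤ) (i : Fin N) (s : ℝ) :
    Function.update (blk N w p) i s = blk N (Function.update w (p - (i : ℕ)) s) p := by
  ext n
  by_cases h : n = i
  · subst h; simp [blk]
  · have : p - ((n : ℕ) : ℤ) ≠ p - ((i : ℕ) : ℤ) := by
      intro h'
      exact h (Fin.ext (by omega))
    rw [Function.update_of_ne h, blk, blk, Function.update_of_ne this]

theorem nrm_update_blk_sq (N : ℕ) (w : ℤ → ℝ) (p : ℤ) (i : Fin N) :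
    nrm (Function.update (blk N w p) i 0) ^ 2 =
      ∑ j ∈ (Finset.Icc (p - N + 1) p).erase (p - (i : ℕ)), w j ^ 2 := by
  rw [blk_update, nrm_blk_sq]
  have hmem : p - (i : ℕ) ∈ Finset.Icc (p - N + 1) p := by
    have := i.2
    simp only [Finset.mem_Icc]
    omega
  rw [← Finset.add_sum_erase _ _ hmem, Function.update_self, zero_pow two_ne_zero, zero_add]
  refine Finset.sum_congr rfl fun j hj => ?_
  rw [Function.update_of_ne (Finset.ne_of_mem_erase hj)]

/-- As `x m` lies in `(0,1)` and `φ` lives on `[0,N]`, only the `N` translates `k = p-N+1, ..., p`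
are active at `x m + p`. -/
theorem signal_eq_mulVec {φ : ℝ → ℝ} {N : ℕ} (hφ : ∀ t : ℝ, t ∉ Set.Icc (0 : ℝ) N → φ t = 0)
    {x : Fin (2 * N - 1) → ℝ} (hx : ∀ m, x m ∈ Set.Ioo (0 : ℝ) 1) (c : ℤ → ℝ) (p : ℤ)
    (m : Fin (2 * N - 1)) : signal φ c (x m + p) = (Phi φ N x *ᵥ blk N c p) m := by
  have h1 : signal φ c (x m + p) =
      ∑ k ∈ Finset.Icc (p - N + 1) p, c k * φ (x m + p - k) := by
    refine tsum_eq_sum fun k hk => ?_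
    rw [hφ, mul_zero]
    simp only [Finset.mem_Icc, not_and_or, not_le] at hk
    obtain ⟨h0, h1⟩ := hx m
    rw [Set.mem_Icc, not_and_or, not_le, not_le]
    rcases hk with hk | hk
    · right
      have : (k : ℝ) + N ≤ p := by exact_mod_cast (by omega : k + N ≤ p)
      linarith
    · left
      have : (p : ℝ) + 1 ≤ k := by exact_mod_cast hk
      linarith
  rw [h1, ← sum_blk N (fun k => c k * φ (x m + p - k))]
  refine Finset.sum_congr rfl fun n _ => ?_
  simp only [Phi, blk, Matrix.of_apply]
  rw [mul_comm]
  congr 2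
  push_cast
  ring

theorem objective_eq (φ : ℝ → ℝ) (N : ℕ) (x : Fin (2 * N - 1) → ℝ) (z : ℝ → ℝ) (p : ℤ)
    (d : ℤ → ℝ) :
    objective φ N x z p d =
      nrm (fun m => |(Phi φ N x *ᵥ blk N d p) m| - √(z (x m + p))) ^ 2 := by
  rw [nrm_sq]
  refine Finset.sum_congr rfl fun m _ => ?_
  rw [sq_abs, ← sum_blk N (fun k => d k * φ (x m + p - k))]
  congr 3
  refine Finset.sum_congr rfl fun n _ => ?_
  simp only [Phi, blk, Matrix.of_apply]
  rw [mul_comm]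
  congr 2
  push_cast
  ring

/-! ### The local minimizers -/

/-- A quantitative complement property. In each row `||a| - |b||` equals `|a - b|` or `|a + b|`, and
by pigeonhole one alternative holds in at least `N` of the `2N-1` rows. -/
theorem exists_sign_of_abs_sub {N : ℕ} {Ψ : Matrix (Fin (2 * N - 1)) (Fin N) ℝ} {A B μ : ℝ}
    (hΨ : StableBounds Ψ A B μ) (u w : Fin N → ℝ) :
    ∃ δ : ℝ, (δ = 1 ∨ δ = -1) ∧
      nrm (w - δ • u) ≤ B * nrm (fun m => |(Ψ *ᵥ w) m| - |(Ψ *ᵥ u) m|) := by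
  classical
  set ζ : Fin (2 * N - 1) → ℝ := fun m => |(Ψ *ᵥ w) m| - |(Ψ *ᵥ u) m| with hζ
  have key : ∀ (δ : ℝ) (T : Finset (Fin (2 * N - 1))), N ≤ T.card →
      (∀ m ∈ T, |(Ψ *ᵥ w) m - δ * (Ψ *ᵥ u) m| = |ζ m|) → nrm (w - δ • u) ≤ B * nrm ζ := by
    intro δ T hT h
    set s := T.orderEmbOfCardLe hT
    refine (hΨ.lower s s.injective _).trans (mul_le_mul_of_nonneg_left ?_ hΨ.B_pos.le)
    refine le_trans (nrm_mono fun n => ?_) (nrm_comp_le s.injective ζ)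
    rw [← h _ (T.orderEmbOfCardLe_mem hT n), mulVec_sub, mulVec_smul]
    exact le_of_eq rfl
  set T := Finset.univ.filter fun m => |(Ψ *ᵥ w) m - 1 * (Ψ *ᵥ u) m| = |ζ m| with hT
  rcases le_or_gt N T.card with hc | hc
  · exact ⟨1, Or.inl rfl, key 1 T hc fun m hm => (Finset.mem_filter.1 hm).2⟩
  · refine ⟨-1, Or.inr rfl, key (-1) Tᶜ ?_ fun m hm => ?_⟩
    · rw [Finset.card_compl, Fintype.card_fin]
      omega
    · have hm' : |(Ψ *ᵥ w) m - 1 * (Ψ *ᵥ u) m| ≠ |ζ m| := by simpa [hT] using hm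
      simp only [hζ] at hm' ⊢
      rcases abs_cases ((Ψ *ᵥ w) m) with h | h <;> rcases abs_cases ((Ψ *ᵥ u) m) with h' | h'
      · rw [h.1, h'.1, one_mul] at hm'
        exact absurd rfl hm'
      · rw [h.1, h'.1]; congr 1; ring
      · rw [h.1, h'.1, ← abs_neg]; congr 1; ring
      · rw [h.1, h'.1, one_mul, ← abs_neg] at hm'
        exact absurd (congrArg abs (by ring)) hm'

theorem exists_sign_of_isLocalMinimizer {φ : ℝ → ℝ} {N : ℕ} {x : Fin (2 * N - 1) → ℝ}
    {A B μ E : ℝ} (hΨ : StableBounds (Phi φ N x) A B μ) {z : ℝ → ℝ} {p : ℤ} {c d : ℤ → ℝ}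
    (hz : ∀ m, |z (x m + p) - (Phi φ N x *ᵥ blk N c p) m ^ 2| ≤ E)
    (hd : IsLocalMinimizer φ N x z p d) :
    ∃ δ : ℝ, (δ = 1 ∨ δ = -1) ∧ nrm (blk N (d - δ • c) p) ≤ B * √(8 * N * E) := by
  obtain ⟨δ, hδ, h⟩ := exists_sign_of_abs_sub hΨ (blk N c p) (blk N d p)
  refine ⟨δ, hδ, h.trans (mul_le_mul_of_nonneg_left ?_ hΨ.B_pos.le)⟩
  -- The true coefficients compete in the minimization. Both objectives are at most `2N·E`, and the
  -- triangle inequality doubles the norm, whence `√(8NE)`.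
  have h1 := hd.2 c
  rw [objective_eq, objective_eq, sq_le_sq₀ (nrm_nonneg _) (nrm_nonneg _)] at h1
  have h2 : nrm (fun m => |(Phi φ N x *ᵥ blk N c p) m| - √(z (x m + p))) ≤ √(2 * N) * √E := by
    refine (nrm_le_of_abs_le (Real.sqrt_nonneg E) fun m => ?_).trans
      (mul_le_mul_of_nonneg_right (Real.sqrt_le_sqrt ?_) (Real.sqrt_nonneg _))
    · rw [abs_sub_comm]
      exact abs_sqrt_sub_abs_le (hz m)
    · rw [Fintype.card_fin]
      exact_mod_cast Nat.sub_le _ _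
  have h3 : √(8 * N * E) = 2 * (√(2 * N) * √E) := by
    rw [← Real.sqrt_mul (by positivity), show (8 : ℝ) * N * E = 2 ^ 2 * (2 * N * E) by ring,
      Real.sqrt_mul (by positivity), Real.sqrt_sq (by positivity)]
  have h4 : (fun m => |(Phi φ N x *ᵥ blk N d p) m| - |(Phi φ N x *ᵥ blk N c p) m|) =
      (fun m => |(Phi φ N x *ᵥ blk N d p) m| - √(z (x m + p))) -
        (fun m => |(Phi φ N x *ᵥ blk N c p) m| - √(z (x m + p))) := by
    ext m
    simp
  rw [h3, h4]
  refine (nrm_sub_le _ _).trans ?_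
  linarith

/-! ### The extension step -/

/-- Covers forward steps (`i` first) and backward steps (`i` last) at once. The clause on `τ ≠ δ`
records that a sign can change only across a vanishing window towards a nonzero coefficient. -/
theorem exists_sign_of_extension {φ : ℝ → ℝ} {N : ℕ} {x : Fin (2 * N - 1) → ℝ}
    {A B μ E M S : ℝ} (hΨ : StableBounds (Phi φ N x) A B μ) (hM : 1 ≤ M) (hS : 0 < S)
    {g : Fin N → Fin (2 * N - 1)} (hg : Function.Injective g) {i : Fin N}
    (hv : ∀ n, μ ≤ |Phi φ N x (g n) i|)
    {z : ℝ → ℝ} {y : Fin N → ℝ} {p : ℤ} {c c' c'' : ℤ → ℝ} {δ e : ℝ}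
    (hδ : δ = 1 ∨ δ = -1) (hE : 0 ≤ E)
    (hz : ∀ n, |z (y n) - (Phi φ N x *ᵥ blk N c p) (g n) ^ 2| ≤ E)
    (hc : (S ≤ nrm (Function.update (blk N c p) i 0) ^ 2 ∧
      nrm (blk N c p) ^ 2 ≤ M * nrm (Function.update (blk N c p) i 0) ^ 2) ∨
      Function.update (blk N c p) i 0 = 0)
    (he : nrm (Function.update (blk N (c' - δ • c) p) i 0) ≤ e)
    (heS : 4 * (A * B) * e ≤ √S) (hEe : 8 * N * E * B ^ 2 ≤ e ^ 2)
    (hlow : |h1 (fun n => Phi φ N x (g n) i)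
        (fun n => (Phi φ N x *ᵥ Function.update (blk N c' p) i 0) (g n))| ≤ S / (4 * B ^ 2) →
      c'' = Function.update c' (p - (i : ℕ)) (lsqValue (fun n => Phi φ N x (g n) i) z y))
    (hhigh : S / (4 * B ^ 2) < |h1 (fun n => Phi φ N x (g n) i)
        (fun n => (Phi φ N x *ᵥ Function.update (blk N c' p) i 0) (g n))| →
      (∀ k : ℤ, k < p - N + 1 ∨ p < k → c'' k = c' k) ∧
      ∀ n, (Phi φ N x *ᵥ blk N c'' p) (g n) = signedSample (fun n => Phi φ N x (g n) i)
        (fun n => (Phi φ N x *ᵥ Function.update (blk N c' p) i 0) (g n)) z y n) :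
    ∃ τ : ℝ, (τ = 1 ∨ τ = -1) ∧
      (τ ≠ δ → Function.update (blk N c p) i 0 = 0 ∧ c (p - (i : ℕ)) ≠ 0) ∧
      nrm (blk N (c'' - τ • c) p) ≤ 2 ^ 8 * A ^ 4 * B ^ 3 * M / μ * e ∧
      ∀ k : ℤ, k < p - N + 1 ∨ p < k → c'' k = c' k := by
  have hA0 := hΨ.A_pos
  have hB0 := hΨ.B_pos
  have hAB := hΨ.one_le
  have hμ := hΨ.μ_pos
  have he0 : 0 ≤ e := (nrm_nonneg _).trans he
  set G := (Phi φ N x).submatrix g id with hG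
  have hvs : ∑ n, G n i ^ 2 ≠ 0 := (sum_sq_col_pos hμ hv).ne'
  have hup : ∀ w, nrm (G *ᵥ w) ≤ A * nrm w := hΨ.upper g hg
  have hlo : ∀ w, nrm w ≤ B * nrm (G *ᵥ w) := hΨ.lower g hg
  have hα : (fun n => (Phi φ N x *ᵥ Function.update (blk N c' p) i 0) (g n)) =
      G *ᵥ Function.update (blk N c' p) i 0 := rfl
  have hh1 := h1_eq hvs (G *ᵥ Function.update (blk N c' p) i 0)
  have hδ2 : δ ^ 2 = 1 := by rcases hδ with h | h <;> rw [h] <;> norm_num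
  have hupd : ∀ u : Fin N → ℝ, ∀ τ : ℝ,
      Function.update (blk N c' p) i 0 - Function.update (τ • u) i 0 =
        Function.update (blk N c' p - τ • u) i 0 := by
    intro u τ
    ext n
    by_cases h : n = i
    · subst h; simp
    · simp [h]
  have hsm : ∀ τ : ℝ, Function.update (τ • blk N c p) i 0 =
      τ • Function.update (blk N c p) i 0 := by
    intro τ
    ext n
    by_cases h : n = i
    · subst h; simp
    · simp [h]
  have hnδ : ∀ u : Fin N → ℝ, nrm (δ • u) = nrm u := by
    intro u
    rw [nrm_smul, show |δ| = 1 by rcases hδ with h | h <;> rw [h] <;> norm_num, one_mul]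
  rw [hα] at hlow hhigh
  set X := A ^ 4 * B ^ 3 * M / μ with hX
  have hX' : 2 ^ 8 * A ^ 4 * B ^ 3 * M / μ * e = 2 ^ 8 * (X * e) := by rw [hX]; ring
  have hX0 : 0 ≤ X * e := by positivity
  rw [hX']
  rcases hc with ⟨hcS, hcM⟩ | hc
  · set W := nrm (Function.update (blk N c p) i 0) with hW
    have hSW : √S ≤ W := Real.sqrt_le_iff.2 ⟨nrm_nonneg _, hcS⟩
    have hW0 : 0 < W := (Real.sqrt_pos.2 hS).trans_le hSW
    have he' : nrm (Function.update (blk N c' p) i 0 - Function.update (δ • blk N c p) i 0) ≤ e := by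
      rw [hupd]; exact he
    have hWu : W = nrm (Function.update (δ • blk N c p) i 0) := by rw [hsm, hnδ]
    have hlt : S / (4 * B ^ 2) < |h1 (fun n => Phi φ N x (g n) i)
        (G *ᵥ Function.update (blk N c' p) i 0)| := by
      have h3 := nrm_orth_lower hup hlo hB0 hvs hA0.le he'
      rw [← hWu] at h3
      have h4 : |h1 (fun n => Phi φ N x (g n) i) (G *ᵥ Function.update (blk N c' p) i 0)| =
          nrm (orth (fun n => G n i) (G *ᵥ Function.update (blk N c' p) i 0)) ^ 2 := by
        rw [← hh1]
        exact abs_of_nonneg (hh1 ▸ sq_nonneg _)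
      rw [h4, div_lt_iff₀ (by positivity)]
      set P := nrm (orth (fun n => G n i) (G *ᵥ Function.update (blk N c' p) i 0))
      -- Squared, this gives `h₁ ≥ 9S/(16B²)`, above the threshold `S/(4B²)`.
      have h5 : 3 / 4 * √S ≤ B * P := by nlinarith
      have h6 := Real.sq_sqrt hS.le
      have h7 : (3 / 4 * √S) ^ 2 ≤ (B * P) ^ 2 := pow_le_pow_left₀ (by positivity) h5 2
      nlinarith
    obtain ⟨hout, hsys⟩ := hhigh hlt
    refine ⟨δ, hδ, fun h => absurd rfl h, ?_, hout⟩
    have := nrm_sub_le_of_system hup hlo hA0 hB0 hAB hμ hΨ.μ_le (i := i) hv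
      (u := δ • blk N c p) (u' := blk N c' p) (u'' := blk N c'' p) (z := z) (y := y) (M := M)
      (W := W) (E := E) (e := e) hM ?_ hE hW0 hWu.le ?_ he' (heS.trans hSW) hEe hsys
    · exact this.trans (by linarith)
    · intro n
      rw [mulVec_smul, Pi.smul_apply, smul_eq_mul, mul_pow, hδ2, one_mul]
      exact hz n
    · rw [hnδ]
      refine le_of_sq_le_sq (hcM.trans ?_) (by positivity)
      rw [mul_pow]
      exact mul_le_mul_of_nonneg_right (by nlinarith) (sq_nonneg _)
  · have hα' : nrm (Function.update (blk N c' p) i 0) ≤ e := by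
      have h3 := hupd (blk N c p) δ
      rw [hsm, hc, smul_zero, sub_zero] at h3
      rw [h3]
      exact he
    have hle : |h1 (fun n => Phi φ N x (g n) i)
        (G *ᵥ Function.update (blk N c' p) i 0)| ≤ S / (4 * B ^ 2) := by
      have h4 : |h1 (fun n => Phi φ N x (g n) i) (G *ᵥ Function.update (blk N c' p) i 0)| =
          nrm (orth (fun n => G n i) (G *ᵥ Function.update (blk N c' p) i 0)) ^ 2 := by
        rw [← hh1]
        exact abs_of_nonneg (hh1 ▸ sq_nonneg _)
      have h5 : nrm (orth (fun n => G n i) (G *ᵥ Function.update (blk N c' p) i 0)) ≤ A * e :=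
        (nrm_orth_le hvs _).trans ((hup _).trans (mul_le_mul_of_nonneg_left hα' hA0.le))
      -- Here `h₁ ≤ A²e²`, while `4ABe ≤ √S` gives `A²e² ≤ S/(16B²)`.
      rw [h4, le_div_iff₀ (by positivity)]
      have h6 := Real.sq_sqrt hS.le
      have h7 : (4 * (A * B) * e) ^ 2 ≤ √S ^ 2 := pow_le_pow_left₀ (by positivity) heS 2
      have h8 := pow_le_pow_left₀ (nrm_nonneg _) h5 2
      have h9 := mul_le_mul_of_nonneg_right h8 (by positivity : 0 ≤ 4 * B ^ 2)
      nlinarith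
    have hc'' := hlow hle
    set t := c (p - (i : ℕ)) with ht
    set ℓ := lsqValue (fun n => Phi φ N x (g n) i) z y with hℓ
    have hlsq : |(ℓ - |t|)| ≤ √E / μ := by
      refine abs_lsqValue_sub_le hμ hv (Fin.pos i) fun n => ?_
      have h3 : (Phi φ N x *ᵥ blk N c p) (g n) = t * Phi φ N x (g n) i := by
        have h4 := congrFun (mulVec_eq_add G i (blk N c p)) n
        rw [hc, mulVec_zero, zero_add] at h4
        exact h4
      rw [← h3]
      exact hz n
    have hout : ∀ k : ℤ, k < p - N + 1 ∨ p < k → c'' k = c' k := by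
      intro k hk
      rw [hc'', Function.update_of_ne]
      have := i.2
      omega
    -- The least squares value approximates `|t|`, so the sign must become that of `t`. For `t = 0`
    -- the old sign is kept, so that every change of sign certifies `t ≠ 0`.
    obtain ⟨τ, hτ, hτδ, hτt⟩ : ∃ τ : ℝ, (τ = 1 ∨ τ = -1) ∧ (τ ≠ δ → t ≠ 0) ∧ τ * t = |t| := by
      rcases lt_trichotomy t 0 with h | h | h
      · exact ⟨-1, Or.inr rfl, fun _ => h.ne, by rw [abs_of_neg h]; ring⟩
      · exact ⟨δ, hδ, fun h' => absurd rfl h', by rw [h]; simp⟩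
      · exact ⟨1, Or.inl rfl, fun _ => h.ne', by rw [abs_of_pos h]; ring⟩
    refine ⟨τ, hτ, fun h => ⟨hc, hτδ h⟩, ?_, hout⟩
    have hsplit : blk N (c'' - τ • c) p =
        Function.update (blk N c' p) i 0 + Pi.single i (ℓ - |t|) := by
      have h3 : blk N (c'' - τ • c) p = blk N c'' p - τ • blk N c p := rfl
      rw [h3, hc'', ← blk_update]
      ext n
      by_cases h : n = i
      · subst h
        simp only [Pi.sub_apply, Pi.smul_apply, Pi.add_apply, Function.update_self,
          Pi.single_eq_same, smul_eq_mul, zero_add, ← hτt]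
        rfl
      · have h4 := congrFun hc n
        rw [Function.update_of_ne h] at h4
        simp only [Pi.sub_apply, Pi.smul_apply, Pi.add_apply, Function.update_of_ne h, h4,
          Pi.single_eq_of_ne h, smul_eq_mul, Pi.zero_apply]
        ring
    have hsingle : nrm (Pi.single i (ℓ - |t|) : Fin N → ℝ) ≤ √E / μ := by
      refine nrm_le_of_sq_le (by positivity) ?_
      have : ∑ n, (Pi.single i (ℓ - |t|) : Fin N → ℝ) n ^ 2 = (ℓ - |t|) ^ 2 := by
        simp [Pi.single_apply]
      rw [this]
      exact sq_le_sq.2 (by rwa [abs_of_nonneg (by positivity : 0 ≤ √E / μ)])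
    rw [hsplit]
    refine (nrm_add_le _ _).trans ?_
    have hN1 : (1 : ℝ) ≤ N := by exact_mod_cast Nat.succ_le_of_lt (Fin.pos i)
    have h3 : √E * B ≤ e := by
      refine le_of_sq_le_sq ?_ he0
      rw [mul_pow, Real.sq_sqrt hE]
      have : 0 ≤ E * B ^ 2 := by positivity
      nlinarith
    have h4 : √E / μ ≤ X * e := by
      rw [hX, div_mul_eq_mul_div]
      refine div_le_div_of_nonneg_right ?_ hμ.le
      calc √E = √E * 1 ^ 4 * 1 := by ring
        _ ≤ √E * (A * B) ^ 4 * M := by gcongr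
        _ = A ^ 4 * B ^ 3 * M * (√E * B) := by ring
        _ ≤ _ := by gcongr
    have h5 : e ≤ X * e := by
      refine le_mul_of_one_le_left he0 ?_
      rw [hX, le_div_iff₀ hμ, one_mul]
      calc μ ≤ A * 1 ^ 3 * 1 := by linarith [hΨ.μ_le]
        _ ≤ A * (A * B) ^ 3 * M := by gcongr
        _ = _ := by ring
    linarith

theorem abs_le_nrm_blk {N : ℕ} {w : ℤ → ℝ} {p j : ℤ} (h : p - N + 1 ≤ j) (h' : j ≤ p) :
    |w j| ≤ nrm (blk N w p) := by
  have := abs_apply_le_nrm (blk N w p) ⟨(p - j).toNat, by omega⟩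
  simp only [blk] at this
  rwa [show p - (((p - j).toNat : ℕ) : ℤ) = j by omega] at this

theorem nrm_update_blk_le {N : ℕ} (w : ℤ → ℝ) {p p' : ℤ} {i : Fin N}
    (h : (Finset.Icc (p - N + 1) p).erase (p - (i : ℕ)) ⊆ Finset.Icc (p' - N + 1) p') :
    nrm (Function.update (blk N w p) i 0) ≤ nrm (blk N w p') := by
  refine le_of_sq_le_sq ?_ (nrm_nonneg _)
  rw [nrm_update_blk_sq, nrm_blk_sq]
  exact Finset.sum_le_sum_of_subset_of_nonneg h fun _ _ _ => sq_nonneg _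

theorem nrm_blk_le {N : ℕ} {w : ℤ → ℝ} {p : ℤ} {b : ℝ} (hb : 0 ≤ b)
    (h : ∀ j, p - N + 1 ≤ j → j ≤ p → |w j| ≤ b) : nrm (blk N w p) ≤ √N * b := by
  have := nrm_le_of_abs_le (u := blk N w p) hb fun n => h _ (by have := n.2; omega) (by omega)
  rwa [Fintype.card_fin] at this

/-! ### The windows of the coefficient sequence -/

section window

variable {N : ℕ} {c : ℤ → ℝ}

theorem windowEnergy_eq (k : ℤ) :
    windowEnergy N c k = ∑ j ∈ Finset.Icc k (k + N - 2), c j ^ 2 := by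
  rw [windowEnergy]
  refine Finset.sum_bij (fun l _ => k + l) ?_ ?_ ?_ ?_
  · intro l hl
    simp only [Finset.mem_Icc] at hl ⊢
    omega
  · intro l _ m _ h
    exact add_left_cancel h
  · intro j hj
    simp only [Finset.mem_Icc] at hj
    exact ⟨j - k, by simp only [Finset.mem_Icc]; omega, by ring⟩
  · intro l _
    rw [sq_abs]

theorem windowRatio_eq (k : ℤ) :
    windowRatio N c k =
      (∑ j ∈ Finset.Icc (k - 1) (k + N - 1), c j ^ 2) / windowEnergy N c k := by
  rw [windowRatio]
  congr 1
  refine Finset.sum_bij (fun l _ => k + l) ?_ ?_ ?_ ?_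
  · intro l hl
    simp only [Finset.mem_Icc] at hl ⊢
    omega
  · intro l _ m _ h
    exact add_left_cancel h
  · intro j hj
    simp only [Finset.mem_Icc] at hj
    exact ⟨j - k, by simp only [Finset.mem_Icc]; omega, by ring⟩
  · intro l _
    rw [sq_abs]

theorem S_le_windowEnergy {k : ℤ} (hk : k ∈ window N c) : S N c ≤ windowEnergy N c k := by
  refine csInf_le ⟨0, ?_⟩ ⟨k, hk, rfl⟩
  rintro _ ⟨j, _, rfl⟩
  exact Finset.sum_nonneg fun _ _ => sq_nonneg _

theorem sum_le_M_mul (hS : 0 < S N c) (hM : MFinite N c) {k : ℤ} (hk : k ∈ window N c) :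
    ∑ j ∈ Finset.Icc (k - 1) (k + N - 1), c j ^ 2 ≤ M N c * windowEnergy N c k := by
  have h : windowRatio N c k ≤ M N c := le_csSup hM ⟨k, hk, rfl⟩
  rwa [windowRatio_eq, div_le_iff₀ (hS.trans_le (S_le_windowEnergy hk))] at h

theorem exists_mem_window (hS : 0 < S N c) : ∃ k, k ∈ window N c := by
  by_contra! h
  have h0 : window N c = ∅ := Set.eq_empty_of_forall_notMem h
  -- The real infimum of the empty set is `0`, so positivity of `S` excludes an empty window set.
  rw [S, h0, Set.image_empty, Real.sInf_empty] at hS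
  exact hS.false

theorem one_le_M (hS : 0 < S N c) (hM : MFinite N c) : 1 ≤ M N c := by
  obtain ⟨k, hk⟩ := exists_mem_window hS
  have h1 := sum_le_M_mul hS hM hk
  have h2 := hS.trans_le (S_le_windowEnergy hk)
  have h3 : windowEnergy N c k ≤ ∑ j ∈ Finset.Icc (k - 1) (k + N - 1), c j ^ 2 := by
    rw [windowEnergy_eq]
    refine Finset.sum_le_sum_of_subset_of_nonneg (Finset.Icc_subset_Icc ?_ ?_)
      fun _ _ _ => sq_nonneg _ <;> omega
  by_contra! h
  nlinarith

/-- Leaving the range `K₋-N+1 < k < K₊+1` places the whole support of `c` on one side, so far more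
than the window vanishes. -/
theorem zero_of_notMem_window {k : ℤ} (hk : k ∉ window N c) :
    (∀ j, j < k + N - 1 → c j = 0) ∨ ∀ j, k - 1 < j → c j = 0 := by
  rw [mem_window_iff, not_and_or] at hk
  refine hk.imp (fun h j hj => ?_) fun h j hj => ?_ <;>
  · by_contra hc
    exact h ⟨j, hc, hj⟩

/-- Dichotomy for the window `[k, k + N - 2]` of a block: enough energy, or all zero. -/
theorem window_dichotomy (hS : 0 < S N c) (hM : MFinite N c) {p k : ℤ} {i : Fin N}
    (hk : (Finset.Icc (p - N + 1) p).erase (p - (i : ℕ)) = Finset.Icc k (k + N - 2))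
    (hk' : Finset.Icc (p - N + 1) p ⊆ Finset.Icc (k - 1) (k + N - 1)) :
    (S N c ≤ nrm (Function.update (blk N c p) i 0) ^ 2 ∧
      nrm (blk N c p) ^ 2 ≤ M N c * nrm (Function.update (blk N c p) i 0) ^ 2) ∨
      Function.update (blk N c p) i 0 = 0 := by
  have h1 : nrm (Function.update (blk N c p) i 0) ^ 2 = windowEnergy N c k := by
    rw [nrm_update_blk_sq, hk, windowEnergy_eq]
  by_cases hw : k ∈ window N c
  · left
    rw [h1, nrm_blk_sq]
    exact ⟨S_le_windowEnergy hw, (Finset.sum_le_sum_of_subset_of_nonneg hk'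
      fun _ _ _ => sq_nonneg _).trans (sum_le_M_mul hS hM hw)⟩
  · right
    rw [← nrm_eq_zero, ← sq_eq_zero_iff, h1, windowEnergy_eq]
    refine Finset.sum_eq_zero fun j hj => ?_
    rw [Finset.mem_Icc] at hj
    rcases zero_of_notMem_window hw with h | h <;> rw [h j (by omega), zero_pow two_ne_zero]

theorem zero_of_update_blk_eq_zero (hS : 0 < S N c) {p k : ℤ} {i : Fin N}
    (hk : (Finset.Icc (p - N + 1) p).erase (p - (i : ℕ)) = Finset.Icc k (k + N - 2))
    (h : Function.update (blk N c p) i 0 = 0) :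
    (∀ j, j < k + N - 1 → c j = 0) ∨ ∀ j, k - 1 < j → c j = 0 := by
  refine zero_of_notMem_window fun hw => ?_
  have h1 : nrm (Function.update (blk N c p) i 0) ^ 2 = windowEnergy N c k := by
    rw [nrm_update_blk_sq, hk, windowEnergy_eq]
  rw [h, nrm_zero] at h1
  have := S_le_windowEnergy hw
  rw [← h1] at this
  linarith [zero_pow (M₀ := ℝ) two_ne_zero]

end window

/-! ### The extension steps of the algorithm -/

section extension

variable {φ : ℝ → ℝ} {N : ℕ} {x : Fin (2 * N - 1) → ℝ}

theorem mulVec_update_zero (w : ℤ → ℝ) (p : ℤ) (i : Fin N) (m : Fin (2 * N - 1)) :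
    (Phi φ N x *ᵥ Function.update (blk N w p) i 0) m =
      ∑ l ∈ (Finset.range N).erase i, w (p - l) * φ (x m + l) := by
  have h1 : (Phi φ N x *ᵥ Function.update (blk N w p) i 0) m =
      ∑ l : Fin N, (fun l : ℕ => if l = i then 0 else w (p - l) * φ (x m + l)) l := by
    rw [Matrix.mulVec, dotProduct]
    refine Finset.sum_congr rfl fun l _ => ?_
    by_cases h : l = i
    · subst h; simp
    · have h' : (l : ℕ) ≠ i := fun h' => h (Fin.ext h')
      simp [h, h', Phi, blk, mul_comm]
  rw [h1, Fin.sum_univ_eq_sum_range (fun l : ℕ => if l = i then 0 else w (p - l) * φ (x m + l)),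
    ← Finset.add_sum_erase _ _ (Finset.mem_range.2 i.2), if_pos rfl, zero_add]
  exact Finset.sum_congr rfl fun l hl => if_neg (Finset.ne_of_mem_erase hl)

theorem mulVec_blk (w : ℤ → ℝ) (p : ℤ) (m : Fin (2 * N - 1)) :
    (Phi φ N x *ᵥ blk N w p) m = ∑ l ∈ Finset.range N, w (p - l) * φ (x m + l) := by
  rw [← Fin.sum_univ_eq_sum_range (fun l : ℕ => w (p - l) * φ (x m + l))]
  rw [Matrix.mulVec, dotProduct]
  exact Finset.sum_congr rfl fun l _ => mul_comm _ _

variable {g : Fin N → Fin (2 * N - 1)} {z : ℝ → ℝ} {c : ℤ → ℝ} {A B μ E e₀ R : ℝ} {b : ℤ} {h : ℕ}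

/-- The moving block at step `l` is `[b+l-N+1, b+l]`, so component `j` is frozen after step
`j-(b-N+1)`. Its error thus carries at most that power of `K`, however long the extension is. -/
theorem forward_induction (hN : 2 ≤ N) (hΨ : StableBounds (Phi φ N x) A B μ)
    (hg : Function.Injective g) (hv : ∀ n, μ ≤ |φ (x (g n))|)
    (hS : 0 < S N c) (hM : MFinite N c) (hE : 0 ≤ E)
    (hK : 1 ≤ 2 ^ 8 * A ^ 4 * B ^ 3 * M N c / μ)
    (he₀ : 0 ≤ e₀) (hEe : 8 * N * E * B ^ 2 ≤ e₀ ^ 2)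
    (hR : e₀ * (2 ^ 8 * A ^ 4 * B ^ 3 * M N c / μ) ^ h ≤ R) (hRS : 4 * (A * B) * R ≤ √(S N c))
    {a : ℕ → ℤ → ℝ}
    (hz : ∀ l : ℕ, 1 ≤ l → l ≤ h → ∀ n, |z (x (g n) + (b + l : ℤ)) -
      (Phi φ N x *ᵥ blk N c (b + l)) (g n) ^ 2| ≤ E)
    (hstep : ∀ l : ℕ, 1 ≤ l → l ≤ h → ForwardStep φ (fun n => x (g n)) z (S N c / (4 * B ^ 2))
      (b + l) (a (l - 1)) (a l))
    (h0 : ∃ δ : ℝ, (δ = 1 ∨ δ = -1) ∧ nrm (blk N (a 0 - δ • c) b) ≤ e₀)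
    (hsupp : ∀ k : ℤ, k ≤ b - N ∨ b + 1 ≤ k → a 0 k = 0) (l : ℕ) (hl : l ≤ h) :
    ∃ δ : ℝ, (δ = 1 ∨ δ = -1) ∧
      nrm (blk N (a l - δ • c) (b + l)) ≤ e₀ * (2 ^ 8 * A ^ 4 * B ^ 3 * M N c / μ) ^ l ∧
      (∀ j, b - N + 1 ≤ j → j ≤ b + l → |(a l - δ • c) j| ≤
        e₀ * (2 ^ 8 * A ^ 4 * B ^ 3 * M N c / μ) ^ (min l (j - (b - N + 1)).toNat)) ∧
      ∀ k : ℤ, k < b - N + 1 ∨ b + l < k → a l k = 0 := by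
  set K := 2 ^ 8 * A ^ 4 * B ^ 3 * M N c / μ with hKdef
  have hA0 := hΨ.A_pos
  have hB0 := hΨ.B_pos
  induction l with
  | zero =>
    obtain ⟨δ, hδ, h⟩ := h0
    refine ⟨δ, hδ, by simpa using h, fun j hj hj' => ?_, fun k hk => hsupp k (by omega)⟩
    rw [Nat.zero_min, pow_zero, mul_one]
    exact (abs_le_nrm_blk hj (by simpa using hj')).trans h
  | succ l ih =>
    obtain ⟨δ, hδ, hblk, hcomp, hsup⟩ := ih (by omega)
    set p : ℤ := b + (l + 1 : ℕ) with hp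
    have hpl : p - 1 = b + l := by push_cast at hp; omega
    set i : Fin N := ⟨0, by omega⟩ with hi
    have hk : (Finset.Icc (p - N + 1) p).erase (p - (i : ℕ)) =
        Finset.Icc (p - N + 1) (p - N + 1 + N - 2) := by
      ext j
      simp only [Finset.mem_erase, Finset.mem_Icc, hi]
      omega
    have hk' : Finset.Icc (p - N + 1) p ⊆ Finset.Icc (p - N + 1 - 1) (p - N + 1 + N - 1) :=
      Finset.Icc_subset_Icc (by omega) (by omega)
    have hcol : (fun n => Phi φ N x (g n) i) = fun n => φ (x (g n)) := by
      ext n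
      simp [Phi, hi]
    have hα : alphaFwd φ (fun n => x (g n)) (a l) p =
        fun n => (Phi φ N x *ᵥ Function.update (blk N (a l) p) i 0) (g n) := by
      ext n
      rw [mulVec_update_zero, alphaFwd]
      refine Finset.sum_congr ?_ fun _ _ => rfl
      ext m
      simp only [Finset.mem_erase, Finset.mem_Icc, Finset.mem_range, hi]
      omega
    obtain ⟨hlow, hhigh⟩ := hstep (l + 1) (by omega) hl
    simp only [Nat.add_sub_cancel] at hlow hhigh
    rw [← hp, hα, ← hcol] at hlow hhigh
    have he : nrm (Function.update (blk N (a l - δ • c) p) i 0) ≤ e₀ * K ^ l := by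
      refine (nrm_update_blk_le _ ?_).trans hblk
      rw [hk]
      exact Finset.Icc_subset_Icc (by omega) (by omega)
    have hKl : 1 ≤ K ^ l := one_le_pow₀ hK
    obtain ⟨τ, hτ, hτδ, herr, hout⟩ := exists_sign_of_extension hΨ (one_le_M hS hM) hS hg
      (i := i) (z := z) (y := fun n => x (g n) + p) (p := p) (c := c) (c' := a l)
      (c'' := a (l + 1)) (δ := δ) (e := e₀ * K ^ l) (E := E)
      (fun n => by rw [congrFun hcol n]; exact hv n) hδ hE (hz (l + 1) (by omega) hl)
      (window_dichotomy hS hM hk hk') he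
      (le_trans (mul_le_mul_of_nonneg_left ((mul_le_mul_of_nonneg_left
        (pow_le_pow_right₀ hK (by omega)) he₀).trans hR) (by positivity)) hRS)
      (hEe.trans (pow_le_pow_left₀ he₀ (le_mul_of_one_le_right he₀ hKl) 2))
      (fun h => by simpa [hi] using hlow h)
      (fun h => ⟨(hhigh h).1, fun n => by rw [mulVec_blk]; exact (hhigh h).2 n⟩)
    rw [← hKdef] at herr
    have herr' : nrm (blk N (a (l + 1) - τ • c) p) ≤ e₀ * K ^ (l + 1) :=
      herr.trans (by rw [pow_succ]; linarith)
    -- After a sign change `c` vanishes to the left of `p`, as the alternative would kill `c p`. The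
    -- bounds for frozen components are then insensitive to the sign.
    have hzero : τ ≠ δ → ∀ j, j < p → c j = 0 := by
      intro hne
      obtain ⟨hz0, hcp⟩ := hτδ hne
      rcases zero_of_update_blk_eq_zero hS hk hz0 with h | h
      · exact fun j hj => h j (by omega)
      · exact absurd (h _ (by simp only [hi]; omega)) hcp
    refine ⟨τ, hτ, herr', fun j hj hj' => ?_, fun k hk => ?_⟩
    · rcases le_or_gt (p - N + 1) j with hjp | hjp
      · rw [min_eq_left (by omega)]
        exact (abs_le_nrm_blk hjp hj').trans herr'
      · have h1 : |(a (l + 1) - τ • c) j| = |(a l - δ • c) j| := by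
          simp only [Pi.sub_apply, Pi.smul_apply, smul_eq_mul, hout j (Or.inl hjp)]
          by_cases hne : τ = δ
          · rw [hne]
          · rw [hzero hne j (by omega), mul_zero, mul_zero]
        rw [h1]
        refine (hcomp j hj (by omega)).trans (mul_le_mul_of_nonneg_left ?_ he₀)
        exact pow_le_pow_right₀ hK (by omega)
    · rw [hout k (by omega)]
      exact hsup k (by omega)

/-- The mirror image, started from the initial block with the error left by the forward pass. The
components to its right are only required to stay within the final bound `R`. -/
theorem backward_induction (hN : 2 ≤ N) (hΨ : StableBounds (Phi φ N x) A B μ)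
    (hg : Function.Injective g) (hv : ∀ n, μ ≤ |φ (x (g n) + (N - 1))|)
    (hS : 0 < S N c) (hM : MFinite N c) (hE : 0 ≤ E)
    (hK : 1 ≤ 2 ^ 8 * A ^ 4 * B ^ 3 * M N c / μ)
    (he₀ : 0 ≤ e₀) (hEe : 8 * N * E * B ^ 2 ≤ e₀ ^ 2)
    (hR : e₀ * (2 ^ 8 * A ^ 4 * B ^ 3 * M N c / μ) ^ h ≤ R) (hRS : 4 * (A * B) * R ≤ √(S N c))
    {a : ℕ → ℤ → ℝ}
    (hz : ∀ l : ℕ, 1 ≤ l → l ≤ h → ∀ n, |z (x (g n) + (b - l : ℤ)) -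
      (Phi φ N x *ᵥ blk N c (b - l)) (g n) ^ 2| ≤ E)
    (hstep : ∀ l : ℕ, 1 ≤ l → l ≤ h → BackwardStep φ (fun n => x (g n)) z
      (S N c / (4 * B ^ 2)) (b - l) (a (l - 1)) (a l))
    (h0 : ∃ δ : ℝ, (δ = 1 ∨ δ = -1) ∧ nrm (blk N (a 0 - δ • c) b) ≤ e₀ ∧
      ∀ j, b - N + 1 ≤ j → j ≤ b + h → |(a 0 - δ • c) j| ≤ R)
    (hsupp : ∀ k : ℤ, k < b - N + 1 ∨ b + h < k → a 0 k = 0) (l : ℕ) (hl : l ≤ h) :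
    ∃ δ : ℝ, (δ = 1 ∨ δ = -1) ∧
      nrm (blk N (a l - δ • c) (b - l)) ≤ e₀ * (2 ^ 8 * A ^ 4 * B ^ 3 * M N c / μ) ^ l ∧
      (∀ j, b - l - N + 1 ≤ j → j ≤ b + h → |(a l - δ • c) j| ≤ R) ∧
      ∀ k : ℤ, k < b - l - N + 1 ∨ b + h < k → a l k = 0 := by
  set K := 2 ^ 8 * A ^ 4 * B ^ 3 * M N c / μ with hKdef
  have hA0 := hΨ.A_pos
  have hB0 := hΨ.B_pos
  have hRl : ∀ l ≤ h, e₀ * K ^ l ≤ R := fun l hl =>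
    (mul_le_mul_of_nonneg_left (pow_le_pow_right₀ hK hl) he₀).trans hR
  induction l with
  | zero =>
    obtain ⟨δ, hδ, h1, h2⟩ := h0
    exact ⟨δ, hδ, by simpa using h1, fun j hj hj' => h2 j (by omega) hj',
      fun k hk => hsupp k (by omega)⟩
  | succ l ih =>
    obtain ⟨δ, hδ, hblk, hcomp, hsup⟩ := ih (by omega)
    set q : ℤ := b - (l + 1 : ℕ) with hq
    have hql : q + 1 = b - l := by push_cast at hq; omega
    set i : Fin N := ⟨N - 1, by omega⟩ with hi
    have hqi : q - ((i : ℕ) : ℤ) = q - N + 1 := by simp only [hi]; omega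
    have hk : (Finset.Icc (q - N + 1) q).erase (q - (i : ℕ)) =
        Finset.Icc (q - N + 2) (q - N + 2 + N - 2) := by
      rw [hqi]
      ext j
      simp only [Finset.mem_erase, Finset.mem_Icc]
      omega
    have hk' : Finset.Icc (q - N + 1) q ⊆ Finset.Icc (q - N + 2 - 1) (q - N + 2 + N - 1) :=
      Finset.Icc_subset_Icc (by omega) (by omega)
    have hcol : (fun n => Phi φ N x (g n) i) = fun n => φ (x (g n) + (N - 1)) := by
      ext n
      simp [Phi, hi, Nat.cast_sub (by omega : 1 ≤ N)]
    have hα : alphaBwd φ (fun n => x (g n)) (a l) q =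
        fun n => (Phi φ N x *ᵥ Function.update (blk N (a l) q) i 0) (g n) := by
      ext n
      rw [mulVec_update_zero, alphaBwd]
      refine Finset.sum_congr ?_ fun _ _ => rfl
      ext m
      simp only [Finset.mem_erase, Finset.mem_Icc, Finset.mem_range, hi]
      omega
    obtain ⟨hlow, hhigh⟩ := hstep (l + 1) (by omega) hl
    simp only [Nat.add_sub_cancel] at hlow hhigh
    rw [← hq, hα, ← hcol] at hlow hhigh
    have he : nrm (Function.update (blk N (a l - δ • c) q) i 0) ≤ e₀ * K ^ l := by
      refine (nrm_update_blk_le _ ?_).trans hblk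
      rw [hk]
      exact Finset.Icc_subset_Icc (by omega) (by omega)
    have hKl : 1 ≤ K ^ l := one_le_pow₀ hK
    obtain ⟨τ, hτ, hτδ, herr, hout⟩ := exists_sign_of_extension hΨ (one_le_M hS hM) hS hg
      (i := i) (z := z) (y := fun n => x (g n) + q) (p := q) (c := c) (c' := a l)
      (c'' := a (l + 1)) (δ := δ) (e := e₀ * K ^ l) (E := E)
      (fun n => by rw [congrFun hcol n]; exact hv n) hδ hE (hz (l + 1) (by omega) hl)
      (window_dichotomy hS hM hk hk') he
      (le_trans (mul_le_mul_of_nonneg_left (hRl l (by omega)) (by positivity)) hRS)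
      (hEe.trans (pow_le_pow_left₀ he₀ (le_mul_of_one_le_right he₀ hKl) 2))
      (fun h => by rw [hqi]; exact hlow h)
      (fun h => ⟨(hhigh h).1, fun n => by rw [mulVec_blk]; exact (hhigh h).2 n⟩)
    rw [← hKdef] at herr
    have herr' : nrm (blk N (a (l + 1) - τ • c) q) ≤ e₀ * K ^ (l + 1) :=
      herr.trans (by rw [pow_succ]; linarith)
    -- Now a sign change forces `c` to vanish to the right of `q-N+1`.
    have hzero : τ ≠ δ → ∀ j, q - N + 1 < j → c j = 0 := by
      intro hne
      obtain ⟨hz0, hcp⟩ := hτδ hne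
      rcases zero_of_update_blk_eq_zero hS hk hz0 with h | h
      · exact absurd (h _ (by rw [hqi]; omega)) hcp
      · exact fun j hj => h j (by omega)
    refine ⟨τ, hτ, herr', fun j hj hj' => ?_, fun k hk => ?_⟩
    · rcases le_or_gt j q with hjq | hjq
      · exact (abs_le_nrm_blk hj hjq).trans (herr'.trans (hRl _ hl))
      · have h1 : |(a (l + 1) - τ • c) j| = |(a l - δ • c) j| := by
          simp only [Pi.sub_apply, Pi.smul_apply, smul_eq_mul, hout j (Or.inr hjq)]
          by_cases hne : τ = δ
          · rw [hne]
          · rw [hzero hne j (by omega), mul_zero, mul_zero]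
        rw [h1]
        exact hcomp j (by omega) hj'
    · rw [hout k (by omega)]
      exact hsup k (by omega)

end extension

/-! ### Sewing the local reconstructions -/

/-- With opposite signs each product is close to `-c(j)²`. The cross terms take at most half of the
energy, and `16NR² ≤ s` keeps the remaining `3NR²` below `s/2`, so the sum would be negative. -/
theorem eq_sign_of_inner_nonneg {N : ℕ} {u u' c : ℤ → ℝ} {τ τ' R s : ℝ} {w : ℤ}
    (hτ : τ = 1 ∨ τ = -1) (hτ' : τ' = 1 ∨ τ' = -1) (hs : 0 < s) (hN : 1 ≤ N)
    (hR : N * (4 * R) ^ 2 ≤ s) (hc : s ≤ windowEnergy N c w)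
    (hu : ∀ j ∈ Finset.Icc w (w + N - 2), |u j - τ * c j| ≤ R)
    (hu' : ∀ j ∈ Finset.Icc w (w + N - 2), |u' j - τ' * c j| ≤ R)
    (h : 0 ≤ ∑ j ∈ Finset.Icc w (w + N - 2), u j * u' j) : τ = τ' := by
  by_contra hne
  have hττ : τ' = -τ := by
    rcases hτ with h1 | h1 <;> rcases hτ' with h2 | h2 <;> simp [h1, h2] at hne ⊢
  have hτ2 : τ ^ 2 = 1 := by rcases hτ with h | h <;> rw [h] <;> norm_num
  have hpt : ∀ j ∈ Finset.Icc w (w + N - 2), u j * u' j ≤ -(1 / 2) * c j ^ 2 + 3 * R ^ 2 := by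
    intro j hj
    have h1 := hu j hj
    have h2 := hu' j hj
    rw [hττ] at h2
    set r := u j - τ * c j with hr
    set r' := u' j - -τ * c j with hr'
    have e1 : u j = τ * c j + r := by rw [hr]; ring
    have e2 : u' j = -τ * c j + r' := by rw [hr']; ring
    have h3 : r ^ 2 ≤ R ^ 2 := sq_le_sq.2 (h1.trans (le_abs_self R))
    have h4 : r' ^ 2 ≤ R ^ 2 := sq_le_sq.2 (h2.trans (le_abs_self R))
    have e3 : u j * u' j = -(τ ^ 2 * c j ^ 2) + (τ * c j) * (r' - r) + r * r' := by
      rw [e1, e2]; ring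
    have e4 : (τ * c j) ^ 2 = c j ^ 2 := by rw [mul_pow, hτ2, one_mul]
    rw [e3, hτ2]
    nlinarith [sq_nonneg (τ * c j - (r' - r)), sq_nonneg (r + r')]
  have hsum := h.trans (Finset.sum_le_sum hpt)
  rw [Finset.sum_add_distrib, ← Finset.mul_sum, ← windowEnergy_eq, Finset.sum_const,
    Int.card_Icc, nsmul_eq_mul] at hsum
  have hcard : (((w + N - 2 + 1 - w).toNat : ℕ) : ℝ) ≤ N := by
    exact_mod_cast (by omega : (w + N - 2 + 1 - w).toNat ≤ N)
  have h5 := mul_le_mul_of_nonneg_right hcard (by positivity : 0 ≤ 3 * R ^ 2)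
  nlinarith

theorem sewing {N h : ℕ} (hN : 2 ≤ N) {L : ℤ} (hL : L = 2 * h + 1) {c : ℤ → ℝ} (hS : 0 < S N c)
    {R : ℝ} (hR : N * (4 * R) ^ 2 ≤ S N c) {C : ℤ → ℤ → ℝ} {σ : ℤ → ℝ}
    (hσ : ∀ i, σ i = 1 ∨ σ i = -1)
    (hC : ∀ i, ∃ δ : ℝ, (δ = 1 ∨ δ = -1) ∧
      (∀ j, i * L - h - N + 1 ≤ j → j ≤ i * L + h → |(C i - δ • c) j| ≤ R) ∧
      ∀ k, k < i * L - h - N + 1 ∨ i * L + h < k → C i k = 0)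
    (hinner : ∀ i, 0 ≤ ∑' k, (σ i * C i k) * (σ (i + 1) * C (i + 1) k)) :
    ∃ δ : ℝ, (δ = -1 ∨ δ = 1) ∧ ∀ i k, i * L - h ≤ k → k ≤ i * L + h →
      |σ i * C i k - δ * c k| ≤ R := by
  choose δ hδ herr hsupp using hC
  set τ : ℤ → ℝ := fun i => σ i * δ i with hτdef
  have hτ : ∀ i, τ i = 1 ∨ τ i = -1 := by
    intro i
    rcases hσ i with h1 | h1 <;> rcases hδ i with h2 | h2 <;> simp [hτdef, h1, h2]
  have hτerr : ∀ i j, i * L - h - N + 1 ≤ j → j ≤ i * L + h →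
      |σ i * C i j - τ i * c j| ≤ R := by
    intro i j h1 h2
    have h3 : σ i * C i j - τ i * c j = σ i * ((C i - δ i • c) j) := by
      simp only [hτdef, Pi.sub_apply, Pi.smul_apply, smul_eq_mul]; ring
    rw [h3, abs_mul, show |σ i| = 1 by rcases hσ i with h | h <;> rw [h] <;> norm_num, one_mul]
    exact herr i j h1 h2
  have hnext : ∀ i, (i + 1) * L - h - N + 1 ∈ window N c → τ i = τ (i + 1) := by
    intro i hw
    have e : (i + 1) * L = i * L + 2 * h + 1 := by rw [add_mul, one_mul]; omega
    refine eq_sign_of_inner_nonneg (N := N) (u := fun k => σ i * C i k)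
      (u' := fun k => σ (i + 1) * C (i + 1) k) (hτ i) (hτ (i + 1)) hS (by omega) hR
      (S_le_windowEnergy hw) (fun j hj => ?_) (fun j hj => ?_) ?_
    · rw [Finset.mem_Icc] at hj
      exact hτerr i j (by omega) (by omega)
    · rw [Finset.mem_Icc] at hj
      exact hτerr (i + 1) j (by omega) (by omega)
    -- The supports of neighbouring extended blocks meet only in this window, so the full inner
    -- product reduces to a sum over it.
    · refine (hinner i).trans (le_of_eq (tsum_eq_sum fun k hk => ?_))
      rw [Finset.mem_Icc, not_and_or, not_le, not_le] at hk
      rcases hk with hk | hk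
      · rw [hsupp (i + 1) k (by omega), mul_zero, mul_zero]
      · rw [hsupp i k (by omega), mul_zero, zero_mul]
  have hmono : ∀ i m : ℤ, i ≤ m → i * L ≤ m * L := fun i m him =>
    mul_le_mul_of_nonneg_right him (by omega)
  -- Nonzero coefficients on both sides of a seam put its overlap in the window set, so signs
  -- propagate across every seam between two blocks meeting the support.
  have hchain : ∀ i m : ℤ, i ≤ m → (∃ j, c j ≠ 0 ∧ j ≤ i * L + h) →
      (∃ j, c j ≠ 0 ∧ m * L - h ≤ j) → τ i = τ m := by
    intro i m him
    induction m, him using Int.leInduction with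
    | base => exact fun _ _ => rfl
    | succ m him ih =>
      rintro ⟨j, hj, hji⟩ ⟨j', hj', hjm⟩
      have e : (m + 1) * L = m * L + 2 * h + 1 := by rw [add_mul, one_mul]; omega
      have := hmono i m him
      rw [ih ⟨j, hj, hji⟩ ⟨j', hj', by omega⟩]
      exact hnext m ((mem_window_iff N c _).2 ⟨⟨j, hj, by omega⟩, ⟨j', hj', by omega⟩⟩)
  obtain ⟨j₀, hj₀⟩ : ∃ j, c j ≠ 0 := by
    obtain ⟨k, hk⟩ := exists_mem_window hS
    obtain ⟨⟨j, hj, _⟩, _⟩ := (mem_window_iff N c k).1 hk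
    exact ⟨j, hj⟩
  obtain ⟨i₀, hi₀, hi₀'⟩ : ∃ i : ℤ, i * L - h ≤ j₀ ∧ j₀ ≤ i * L + h := by
    refine ⟨(j₀ + h) / L, ?_, ?_⟩
    · have := Int.ediv_mul_le (j₀ + h) (by omega : L ≠ 0)
      omega
    · have := Int.lt_ediv_add_one_mul_self (j₀ + h) (by omega : 0 < L)
      rw [add_mul, one_mul] at this
      omega
  refine ⟨τ i₀, (hτ i₀).symm, fun i k hk hk' => ?_⟩
  have h1 := hτerr i k (by omega) hk'
  -- Where `c k = 0` the sign is irrelevant; otherwise block `i` meets the support and is chained to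
  -- the reference block `i₀`.
  by_cases hck : c k = 0
  · rwa [hck, mul_zero] at h1 ⊢
  · suffices h2 : τ i₀ = τ i by rwa [h2]
    rcases le_total i₀ i with hle | hle
    · exact hchain i₀ i hle ⟨j₀, hj₀, hi₀'⟩ ⟨k, hck, hk⟩
    · exact (hchain i i₀ hle ⟨k, hck, hk'⟩ ⟨j₀, hj₀, hi₀⟩).symm

/-- The noise level condition bounds the accumulated error by the window energy. -/
theorem error_bounds {N h : ℕ} (hN : 2 ≤ N) {A B μ M E K s : ℝ} (hA : 0 < A) (hB : 0 < B)
    (hAB : 1 ≤ A * B) (hμ : 0 < μ) (hμA : μ ≤ A) (hM : 1 ≤ M)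
    (hK : K = 2 ^ 8 * A ^ 4 * B ^ 3 * M / μ)
    (hEs : E ≤ s / (2 ^ 7 * (N : ℝ) ^ 3 * B ^ 2 * K ^ (4 * N + 2 * h - 4))) (hE : 0 ≤ E) :
    1 ≤ K ∧ 4 * (A * B) * (N * B * K ^ (N - 1 + h) * √(8 * E)) ≤ √s ∧
      N * (4 * (N * B * K ^ (N - 1 + h) * √(8 * E))) ^ 2 ≤ s := by
  have hABK : A * B ≤ K := by
    rw [hK, le_div_iff₀ hμ]
    calc A * B * μ ≤ A * B * A := by gcongr
      _ = 1 * (A * A * B) * 1 * 1 := by ring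
      _ ≤ 2 ^ 8 * (A * A * B) * (A * B) ^ 2 * M := by
          gcongr
          · norm_num
          · exact one_le_pow₀ hAB
      _ = _ := by ring
  have hK1 := hAB.trans hABK
  have hK0 : 0 < K := by linarith
  have hN0 : (0 : ℝ) < N := by exact_mod_cast (by omega : 0 < N)
  have hN1 : (1 : ℝ) ≤ N := by exact_mod_cast (by omega : 1 ≤ N)
  set R := N * B * K ^ (N - 1 + h) * √(8 * E) with hR
  have hR0 : 0 ≤ R := by positivity
  have hRsq : R ^ 2 = 8 * N ^ 2 * B ^ 2 * K ^ (2 * N + 2 * h - 2) * E := by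
    rw [hR, mul_pow, Real.sq_sqrt (by positivity), mul_pow, mul_pow, ← pow_mul,
      show (N - 1 + h) * 2 = 2 * N + 2 * h - 2 by omega]
    ring
  have hpow : K ^ (4 * N + 2 * h - 4) = K ^ (2 * N + 2 * h - 2) * (K ^ (N - 1)) ^ 2 := by
    rw [← pow_mul, ← pow_add]
    congr 1
    omega
  -- The noise condition is this inequality with `R²` written out. The extra factor `K^(N-1)`, at
  -- least `K ≥ AB`, pays for the factor `AB` in the second conclusion.
  have hEs' : N * (4 * (K ^ (N - 1) * R)) ^ 2 ≤ s := by
    rw [le_div_iff₀ (by positivity), hpow] at hEs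
    calc N * (4 * (K ^ (N - 1) * R)) ^ 2 = 16 * N * (K ^ (N - 1)) ^ 2 * R ^ 2 := by ring
      _ = E * (2 ^ 7 * (N : ℝ) ^ 3 * B ^ 2 * (K ^ (2 * N + 2 * h - 2) * (K ^ (N - 1)) ^ 2)) := by
          rw [hRsq]; ring
      _ ≤ s := hEs
  have hKN : K ≤ K ^ (N - 1) := le_self_pow₀ hK1 (by omega)
  refine ⟨hK1, ?_, ?_⟩
  · refine Real.le_sqrt_of_sq_le (le_trans ?_ hEs')
    calc (4 * (A * B) * R) ^ 2 = 1 * (4 * (A * B * R)) ^ 2 := by ring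
      _ ≤ N * (4 * (K ^ (N - 1) * R)) ^ 2 := by
          have := hABK.trans hKN
          gcongr
  · refine le_trans ?_ hEs'
    have : R ≤ K ^ (N - 1) * R := le_mul_of_one_le_left hR0 (hK1.trans hKN)
    gcongr

end MEPS

end

/-! ### The reconstruction estimate -/

theorem mainTheorem1
    (N : ℕ) (hN : 2 ≤ N) (L : ℕ) (hL : Odd L)
    (φ : ℝ → ℝ) (hφ_cont : Continuous φ) (hφ_supp : ∀ t : ℝ, t ∉ Set.Icc (0 : ℝ) N → φ t = 0)
    (x : Fin (2 * N - 1) → ℝ) (hx : ∀ m, x m ∈ Set.Ioo (0 : ℝ) 1)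
    (hspark : MEPS.FullSpark φ N x)
    (γ γs : Fin N → ℝ)
    (hγ_inj : Function.Injective γ) (hγ_mem : ∀ n, γ n ∈ Set.range x)
    (hγs_inj : Function.Injective γs) (hγs_mem : ∀ n, γs n ∈ Set.range x)
    (hγ_ne : ∀ n, φ (γ n) ≠ 0) (hγs_ne : ∀ n, φ (γs n + (N - 1)) ≠ 0)
    (c : ℤ → ℝ)
    (hnonsep : ¬ MEPS.Separable (MEPS.V φ) (MEPS.signal φ c))
    (hS : 0 < MEPS.S N c) (hM : MEPS.MFinite N c)
    (ε : ℝ → ℝ)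
    (hε_bdd : BddAbove ((fun y => |ε y|) '' MEPS.sampleSet N L x γ γs))
    (hε : MEPS.noiseLevel (MEPS.sampleSet N L x γ γs) ε ≤
      MEPS.S N c /
        (2 ^ 7 * (N : ℝ) ^ 3 * MEPS.normInv φ N x ^ 2 *
          MEPS.constC φ N x γ γs c ^ (4 * N + L - 5)))
    (cε : ℤ → ℝ)
    (hout : MEPS.IsOutput φ N L x γ γs (MEPS.noisySample (MEPS.signal φ c) ε)
      (MEPS.S N c / (4 * MEPS.normInv φ N x ^ 2)) cε) :
    ∃ δ : ℝ, (δ = -1 ∨ δ = 1) ∧ ∀ k : ℤ,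
      |cε k - δ * c k| ≤
        N * MEPS.normInv φ N x * MEPS.constC φ N x γ γs c ^ (N - 1 + (L - 1) / 2) *
          √(8 * MEPS.noiseLevel (MEPS.sampleSet N L x γ γs) ε) := by
  obtain ⟨h, rfl⟩ := hL
  choose g hg using hγ_mem
  choose gs hgs using hγs_mem
  obtain rfl : (fun n => x (g n)) = γ := funext hg
  obtain rfl : (fun n => x (gs n)) = γs := funext hgs
  have hg_inj : Function.Injective g := fun a b hab => hγ_inj (congrArg x hab)
  have hgs_inj : Function.Injective gs := fun a b hab => hγs_inj (congrArg x hab)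
  set Y := MEPS.sampleSet N (2 * h + 1) x (fun n => x (g n)) (fun n => x (gs n)) with hY
  set E := MEPS.noiseLevel Y ε with hEdef
  set K := MEPS.constC φ N x (fun n => x (g n)) (fun n => x (gs n)) c with hKdef
  set B := MEPS.normInv φ N x with hBdef
  set A := MEPS.opNorm (MEPS.Phi φ N x) with hAdef
  have hh : (2 * h + 1 - 1) / 2 = h := by omega
  have : Nonempty (Fin N) := ⟨⟨0, by omega⟩⟩
  -- the minimum in the denominator of the constant
  set F : Fin N → ℝ := fun n => min |φ (x (g n))| |φ (x (gs n) + (N - 1))| with hF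
  set μ := ⨅ n, F n with hμdef
  have hμle : ∀ n, μ ≤ F n := fun n => ciInf_le (Set.finite_range F).bddBelow n
  have hμ : 0 < μ := by
    obtain ⟨n, hn⟩ := exists_eq_ciInf_of_finite (f := F)
    rw [hμdef, ← hn]
    exact lt_min (abs_pos.2 (hγ_ne n)) (abs_pos.2 (hγs_ne n))
  have hv : ∀ n, μ ≤ |φ (x (g n))| := fun n => (hμle n).trans (min_le_left _ _)
  have hvs : ∀ n, μ ≤ |φ (x (gs n) + (N - 1))| := fun n => (hμle n).trans (min_le_right _ _)
  have hΨ : MEPS.StableBounds (MEPS.Phi φ N x) A B μ := by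
    refine MEPS.stableBounds_phi hspark hg_inj ⟨0, by omega⟩ hμ ((hv ⟨0, by omega⟩).trans ?_)
    simp [MEPS.Phi]
  have hE : 0 ≤ E := Real.sSup_nonneg (by rintro _ ⟨y, _, rfl⟩; exact abs_nonneg _)
  have hεE : ∀ y ∈ Y, |ε y| ≤ E := fun y hy => le_csSup hε_bdd ⟨y, hy, rfl⟩
  have hz : ∀ (m : Fin (2 * N - 1)) (p : ℤ), x m + (p : ℝ) ∈ Y →
      |MEPS.noisySample (MEPS.signal φ c) ε (x m + p) -
        (MEPS.Phi φ N x).mulVec (MEPS.blk N c p) m ^ 2| ≤ E := by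
    intro m p hp
    rw [MEPS.noisySample, sq_abs, MEPS.signal_eq_mulVec hφ_supp hx, add_sub_cancel_left]
    exact hεE _ hp
  have hKeq : K = 2 ^ 8 * A ^ 4 * B ^ 3 * MEPS.M N c / μ := rfl
  obtain ⟨hK1, hRS, hRs⟩ := MEPS.error_bounds (h := h) hN hΨ.A_pos hΨ.B_pos hΨ.one_le hΨ.μ_pos
    hΨ.μ_le (MEPS.one_le_M hS hM) hKeq (E := E)
    (by rwa [show 4 * N + (2 * h + 1) - 5 = 4 * N + 2 * h - 4 by omega] at hε) hE
  rw [hh]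
  set R := N * B * K ^ (N - 1 + h) * √(8 * E) with hR
  have hB0 := hΨ.B_pos
  have hN1 : (1 : ℝ) ≤ N := by exact_mod_cast (by omega : 1 ≤ N)
  have hK0 : 0 < K := by linarith
  have hR0 : 0 ≤ R := by positivity
  set e₀ := B * √(8 * N * E) with he₀
  have he₀0 : 0 ≤ e₀ := by positivity
  have he₀sq : 8 * N * E * B ^ 2 = e₀ ^ 2 := by
    rw [he₀, mul_pow, Real.sq_sqrt (by positivity)]
    ring
  -- One `√N` comes from the minimizer bound, the other from passing from components to the norm of
  -- a block; together they give the factor `N` in `R`.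
  have hRe : √N * (e₀ * K ^ (N - 1)) * K ^ h = R := by
    rw [he₀, hR, pow_add, show 8 * N * E = N * (8 * E) by ring, Real.sqrt_mul (by positivity)]
    linear_combination (B * √(8 * E) * K ^ (N - 1) * K ^ h) *
      Real.mul_self_sqrt (by positivity : (0 : ℝ) ≤ N)
  have hsN : 1 ≤ √N := Real.one_le_sqrt.2 hN1
  have hKN : 1 ≤ K ^ (N - 1) := one_le_pow₀ hK1
  have hR1 : e₀ * K ^ h ≤ R := by
    rw [← hRe]
    gcongr
    calc e₀ = 1 * (e₀ * 1) := by ring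
      _ ≤ √N * (e₀ * K ^ (N - 1)) := by gcongr
  obtain ⟨cHalf, cOne, σ, hmin, hfwd, hjoin, hbwd, hσ, hinner, hcε⟩ := hout
  rw [hh] at hfwd hjoin hbwd hinner hcε
  have hlocal : ∀ i : ℤ, ∃ δ : ℝ, (δ = 1 ∨ δ = -1) ∧
      (∀ j, i * ((2 * h + 1 : ℕ) : ℤ) - h - N + 1 ≤ j → j ≤ i * ((2 * h + 1 : ℕ) : ℤ) + h →
        |(cOne i h - δ • c) j| ≤ R) ∧
      ∀ k, k < i * ((2 * h + 1 : ℕ) : ℤ) - h - N + 1 ∨ i * ((2 * h + 1 : ℕ) : ℤ) + h < k →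
        cOne i h k = 0 := by
    intro i
    set b : ℤ := i * ((2 * h + 1 : ℕ) : ℤ) with hb
    have hbR : (b : ℝ) = ((2 * h + 1 : ℕ) : ℝ) * i := by rw [hb]; push_cast; ring
    have hstart := MEPS.exists_sign_of_isLocalMinimizer hΨ
      (fun m => hz m b ⟨x m, i, by rw [hbR], Or.inl ⟨m, rfl⟩⟩) (hmin i)
    obtain ⟨δ, hδ, -, hcomp, hsup⟩ := MEPS.forward_induction (h := h) hN hΨ hg_inj hv hS hM hE
      (hKeq ▸ hK1) he₀0 he₀sq.le (hKeq ▸ hR1) hRS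
      (fun l h1 h2 n => hz (g n) (b + l) ⟨x (g n) + l, i, by push_cast [hbR]; ring,
        Or.inr (Or.inl ⟨n, l, h1, by omega, rfl⟩)⟩)
      (hfwd i) hstart (hmin i).1 h le_rfl
    rw [← hKeq] at hcomp
    -- On the initial block the forward pass costs at most `K^(N-1)`, whatever `h` is. Hence the
    -- final exponent is `N-1+h`.
    have hcompN : ∀ j, b - N + 1 ≤ j → j ≤ b → |(cOne i 0 - δ • c) j| ≤ e₀ * K ^ (N - 1) := by
      intro j hj hj'
      rw [hjoin i]
      refine (hcomp j hj (by omega)).trans ?_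
      have := pow_le_pow_right₀ hK1
        (by omega : min h (j - (b - N + 1)).toNat ≤ N - 1)
      gcongr
    have hcompR : ∀ j, b - N + 1 ≤ j → j ≤ b + h → |(cOne i 0 - δ • c) j| ≤ R := by
      intro j hj hj'
      rw [hjoin i]
      refine (hcomp j hj hj').trans (le_trans ?_ hR1)
      have := pow_le_pow_right₀ hK1 (min_le_left h (j - (b - N + 1)).toNat)
      gcongr
    have he₁ : e₀ ≤ √N * (e₀ * K ^ (N - 1)) := by
      calc e₀ = 1 * (e₀ * 1) := by ring
        _ ≤ √N * (e₀ * K ^ (N - 1)) := by gcongr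
    obtain ⟨δ', hδ', -, hres, hres'⟩ := MEPS.backward_induction (h := h) hN hΨ hgs_inj hvs hS hM hE
      (hKeq ▸ hK1) (he₀0.trans he₁) (he₀sq.le.trans (pow_le_pow_left₀ he₀0 he₁ 2))
      (hKeq ▸ hRe.le) hRS
      (fun l h1 h2 n => hz (gs n) (b - l) ⟨x (gs n) - l, i, by push_cast [hbR]; ring,
        Or.inr (Or.inr ⟨n, l, h1, by omega, rfl⟩)⟩)
      (hbwd i) ⟨δ, hδ, MEPS.nrm_blk_le (by positivity) hcompN, hcompR⟩
      (by rw [hjoin i]; exact hsup) h le_rfl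
    exact ⟨δ', hδ', hres, hres'⟩
  obtain ⟨δ, hδ, hfin⟩ := MEPS.sewing hN (L := ((2 * h + 1 : ℕ) : ℤ)) (by push_cast; ring) hS
    hRs hσ hlocal hinner
  refine ⟨δ, hδ, fun k => ?_⟩
  rw [hcε k]
  -- This floor is that of `(k+h)/L`, the unique block index with `iL-h ≤ k ≤ iL+h`.
  set i := ⌊(2 * (k : ℝ) + ((2 * h + 1 : ℕ) : ℝ) - 1) / (2 * ((2 * h + 1 : ℕ) : ℝ))⌋ with hi
  have hpos : (0 : ℝ) < 2 * ((2 * h + 1 : ℕ) : ℝ) := by positivity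
  have h1 := Int.floor_le ((2 * (k : ℝ) + ((2 * h + 1 : ℕ) : ℝ) - 1) / (2 * ((2 * h + 1 : ℕ) : ℝ)))
  have h2 := Int.lt_floor_add_one
    ((2 * (k : ℝ) + ((2 * h + 1 : ℕ) : ℝ) - 1) / (2 * ((2 * h + 1 : ℕ) : ℝ)))
  rw [← hi, le_div_iff₀ hpos] at h1
  rw [← hi, div_lt_iff₀ hpos] at h2
  have h1' : i * (2 * ((2 * h + 1 : ℕ) : ℤ)) ≤ 2 * k + ((2 * h + 1 : ℕ) : ℤ) - 1 := by
    exact_mod_cast h1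
  have h2' : 2 * k + ((2 * h + 1 : ℕ) : ℤ) - 1 < (i + 1) * (2 * ((2 * h + 1 : ℕ) : ℤ)) := by
    exact_mod_cast h2
  have e1 : i * (2 * ((2 * h + 1 : ℕ) : ℤ)) = 2 * (i * ((2 * h + 1 : ℕ) : ℤ)) := by ring
  have e2 : (i + 1) * (2 * ((2 * h + 1 : ℕ) : ℤ)) =
      2 * (i * ((2 * h + 1 : ℕ) : ℤ)) + 2 * (2 * h + 1) := by push_cast; ring
  rw [e1] at h1'
  rw [e2] at h2'
  push_cast at h1' h2' ⊢
  exact hfin i k (by push_cast; omega) (by push_cast; omega)
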